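/- All graphs are finite and simple. Let $G$ be a graph and let $D_1,\dots,D_s$ ($s\ge 0$) be independent sets of vertices of $G$. In the vertex colouring game with blanks on $G$ with $k$ colours and with $D_1,\dots,D_s$ marked for blanks, two players, Maker and Breaker, alternately play at unplayed vertices of $G$, Maker going first. A list of classes currently marked for blanks is kept, which initially consists of $D_1,\dots,D_s$. On each turn the player to move does one of the following. - Either player may give an unplayed vertex one of the $k$ colours, provided that no neighbour of that vertex has this colour. - Breaker may play a blank at any unplayed vertex $v$, and when doing so he may also (but need not) choose a class $D_i\not\ni v$ that is currently marked for blanks and remove it from the list. - Maker may play a blank at any unplayed vertex that lies in some class currently marked for blanks. Blanks are not colours, and they do not restrict later play. The game ends as soon as no vertex can legally be given a colour and every vertex in the classes currently marked for blanks has been played. Maker wins if at the end every vertex has been played (given a colour or a blank); otherwise Breaker wins. Let $\chi_{\mathrm{gb}}(G;D_1,\dots,D_s)$ be the minimum number $k\geq 0$ of colours for which Maker has a winning strategy in this game. Let $T(2r,r)$ be the Turán graph on $2r$ vertices, that is, the complete $r$-partite graph with all parts of size $2$. **Theorem.** Let $G$ be a graph with $n\ge 2$ vertices, and let $C_1,\dots,C_p$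 be a partition of $V(G)$ into $p\ge\chi(G)$ pairwise disjoint independent sets. Let $0\le s\le p$, and let $D_1,\dots,D_s$ be some $s$ of the sets $C_1,\dots,C_p$ (with distinct indices). Assume that either $s\ge 1$, or that $n\ge 6$ and $G$ is not isomorphic to $T(2r,r)$ for any $r$. Then $$\chi_{\mathrm{gb}}(G;D_1,\dots,D_s)\le p+\lfloor n/2\rfloor-2 .$$ -/

import Mathlib

namespace BlankGame

/-- The status of a vertex when `k` colours are available. Blanks are not colours. -/
inductive Status (k : ℕ) where
  | unplayed : Status k
  | blank : Status k
  | colour (c : Fin k) : Status k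

/-- The two players. -/
inductive Player where
  | maker : Player
  | breaker : Player

/-- A position of the game with `k` colours: the status of every vertex, together with the list of
indices `i` for which the class `D i` is still marked for blanks. -/
structure Position (V ι : Type*) (k : ℕ) where
  status : V → Status k
  marked : Finset ι

section Game

variable {V ι : Type*} {k : ℕ}

/-- No vertex has been played and all the classes are marked for blanks. -/
def Position.initial (V ι : Type*) [Fintype ι] (k : ℕ) : Position V ι k where
  status := fun _ => Status.unplayed
  marked := Finset.univ

/-- The position after vertex `v` has been given status `m`. -/
def Position.play [DecidableEq V] (P : Position V ι k) (v : V) (m : Status k) :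
    Position V ι k where
  status := Function.update P.status v m
  marked := P.marked

/-- The position after `D i` has been removed from the list of classes marked for blanks. -/
def Position.unmark [DecidableEq ι] (P : Position V ι k) (i : ι) : Position V ι k where
  status := P.status
  marked := P.marked.erase i

/-- Every vertex has been given a colour or a blank. -/
def Position.Filled (P : Position V ι k) : Prop :=
  ∀ v, P.status v ≠ Status.unplayed

/-- Colour `c` can legally be given to the vertex `v`: it is unplayed, and no neighbour of `v` has
colour `c`. -/
def Position.CanColour (P : Position V ι k) (G : SimpleGraph V) (v : V) (c : Fin k) : Prop :=
  P.status v = Status.unplayed ∧ ∀ w, G.Adj v w → P.status w ≠ Status.colour c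

/-- `v` is an unplayed vertex of a class which is currently marked for blanks. -/
def Position.OpenForBlank (P : Position V ι k) (D : ι → Finset V) (v : V) : Prop :=
  P.status v = Status.unplayed ∧ ∃ i ∈ P.marked, v ∈ D i

/-- The game has ended: no vertex can legally be given a colour, and no vertex in the union of the
classes currently marked for blanks is left unplayed. -/
def Position.Ended (P : Position V ι k) (G : SimpleGraph V) (D : ι → Finset V) : Prop :=
  (∀ v c, ¬ P.CanColour G v c) ∧ ∀ v, ¬ P.OpenForBlank D v

variable [DecidableEq V] [DecidableEq ι]

/-- The legal moves, in a position in which the game has not ended. -/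
inductive Move (G : SimpleGraph V) (D : ι → Finset V) (P : Position V ι k) :
    Player → Position V ι k → Prop where
  /-- Either player gives a vertex a colour not used on its neighbours. -/
  | colour (player : Player) (v : V) (c : Fin k) (h : P.CanColour G v c) :
      Move G D P player (P.play v (Status.colour c))
  /-- Maker plays a blank in a class marked for blanks. -/
  | makerBlank (v : V) (h : P.OpenForBlank D v) :
      Move G D P Player.maker (P.play v Status.blank)
  /-- Breaker plays a blank at any unplayed vertex, and leaves the marked classes as they are. -/
  | breakerBlank (v : V) (h : P.status v = Status.unplayed) :
      Move G D P Player.breaker (P.play v Status.blank)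
  /-- Breaker plays a blank at any unplayed vertex `v`, and removes a class not containing `v` from
  the list of classes marked for blanks. -/
  | breakerBlankUnmark (v : V) (h : P.status v = Status.unplayed) (i : ι) (hi : i ∈ P.marked)
      (hv : v ∉ D i) :
      Move G D P Player.breaker ((P.play v Status.blank).unmark i)

/-- `MakerWinsFrom G D player P`: Maker has a winning strategy from position `P` when it is the turn
of `player`. Maker wins once all vertices have been played; if the game ends before that, she
loses. -/
inductive MakerWinsFrom (G : SimpleGraph V) (D : ι → Finset V) :
    Player → Position V ι k → Prop where
  | filled (player : Player) (P : Position V ι k) (h : P.Filled) : MakerWinsFrom G D player P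
  | maker (P Q : Position V ι k) (hE : ¬ P.Ended G D) (hQ : Move G D P Player.maker Q)
      (h : MakerWinsFrom G D Player.breaker Q) : MakerWinsFrom G D Player.maker P
  | breaker (P : Position V ι k) (hE : ¬ P.Ended G D)
      (h : ∀ Q, Move G D P Player.breaker Q → MakerWinsFrom G D Player.maker Q) :
      MakerWinsFrom G D Player.breaker P

variable [Fintype ι]

/-- Maker, who moves first, wins the vertex colouring game with blanks on `G` with `k` colours and
with the classes `D i` marked for blanks. -/
def MakerWins (G : SimpleGraph V) (D : ι → Finset V) (k : ℕ) : Prop :=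
  MakerWinsFrom G D Player.maker (Position.initial V ι k)

/-- The generalised game-with-blanks number: the minimum number of colours for which Maker wins. It
is `⊤` if there is no such number. -/
noncomputable def chiGB (G : SimpleGraph V) (D : ι → Finset V) : ℕ∞ :=
  ⨅ k ∈ {k : ℕ | MakerWins G D k}, (k : ℕ∞)

end Game

end BlankGame

set_option linter.unusedSectionVars false

/-! An old colour that is absent from the neighbourhood of an independent class of unplayed vertices
helps Maker just as a class marked for blanks does: with either she can play any vertex of that
class without spending an unused colour, and Breaker can destroy the help only by playing outside
the class. So a position is summarised by the set `U` of unplayed vertices, a partition `f` of `U`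
into independent classes, the set `M` of labels helped in this way (called marked below), and a
lower bound `k` on the number of unused colours. A reply of Breaker either spends an unused colour,
which marks the class of the vertex played, or spends none and spoils at most one mark, of another
class.

Let n be the number of unplayed vertices and q the number of nonempty classes. A round of two moves
lowers ⌊n/2⌋ by one. Induction on n (`wins_weak_and_strong`) shows that Maker wins if q + ⌊n/2⌋ ≤ k
+ 1, and also if q + ⌊n/2⌋ ≤ k + 2 and some nonempty class is marked. At the start q ≤ p and k = p +
⌊n/2⌋ - 2, so this settles s ≥ 1; if the marked class is empty, then q < p.

For s = 0 the bound k + 2 has to be reached without a mark (`wins_of_notTuran`). If Maker opens with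
a new colour and Breaker answers with another one, the sum can be as large as k + 3 for the new k.
Maker survives this if she can remove a singleton class (`wins_of_alone_marked`), if two classes are
marked (`wins_of_two_marked`, `wins_of_two_labels`), or if one class is marked among large ones
(`wins_of_marked_among_large`). She may also repartition the unplayed vertices after a round
(`Wins.round`). The sizes of the classes decide where she opens. Two kinds of bipartite position
escape this scheme and are won directly, by keeping a colour available at every vertex: two equal
classes, and sizes 3 and 4 with a matching of nonadjacent pairs. If all classes have size 2, one
more nonadjacent pair is needed, and this is what the Turán graph lacks. -/

namespace BlankGame

/-! ### Abstract positions and the effect of each move on them. -/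

section Positions

open Finset

variable {V ι : Type*} {K : ℕ} {G : SimpleGraph V} {D : ι → Finset V}

/-- `U` is the set of unplayed vertices, and no colour of `F` has been used. -/
structure Position.IsFresh (P : Position V ι K) (U : Finset V) (F : Finset (Fin K)) : Prop where
  mem_iff : ∀ v, v ∈ U ↔ P.status v = Status.unplayed
  unused : ∀ c ∈ F, ∀ v, P.status v ≠ Status.colour c

/-- The labelling `f` is a proper colouring of the subgraph induced by `U`. -/
def ProperOn (G : SimpleGraph V) (U : Finset V) (f : V → ℕ) : Prop :=
  ∀ u ∈ U, ∀ w ∈ U, f u = f w → ¬ G.Adj u w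

theorem ProperOn.mono {U U' : Finset V} {f : V → ℕ} (h : ProperOn G U f) (hU : U' ⊆ U) :
    ProperOn G U' f := fun u hu w hw => h u (hU hu) w (hU hw)

/-- The vertices satisfying `A` can be played without using up a colour of `F`: either because they
lie in a class marked for blanks, or because they can all be given the same colour outside `F`. -/
def Position.Serves (P : Position V ι K) (G : SimpleGraph V) (D : ι → Finset V)
    (F : Finset (Fin K)) (A : V → Prop) : ι ⊕ Fin K → Prop
  | Sum.inl t => t ∈ P.marked ∧ ∀ v, A v → v ∈ D t
  | Sum.inr c => c ∉ F ∧ ∀ v, A v → ∀ w, G.Adj v w → P.status w ≠ Status.colour c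

/-- In the position `P` the unplayed vertices are those of `U`, they are partitioned into
independent classes by `f`, the classes with a label in `M` are served by different classes marked
for blanks or old colours, and at least `k` colours are unused. -/
def Position.Realises (P : Position V ι K) (G : SimpleGraph V) (D : ι → Finset V) (U : Finset V)
    (f : V → ℕ) (M : Finset ℕ) (k : ℕ) : Prop :=
  ProperOn G U f ∧ ∃ F : Finset (Fin K), P.IsFresh U F ∧ k ≤ #F ∧
    ∃ τ : ℕ → ι ⊕ Fin K, Set.InjOn τ M ∧
      ∀ i ∈ M, P.Serves G D F (fun v => v ∈ U ∧ f v = i) (τ i)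

theorem Position.Realises.mono {P : Position V ι K} {U : Finset V} {f : V → ℕ} {M M' : Finset ℕ}
    {k k' : ℕ} (h : P.Realises G D U f M k) (hM : M' ⊆ M) (hk : k' ≤ k) :
    P.Realises G D U f M' k' := by
  obtain ⟨hp, F, hF, hkF, τ, hτ, hs⟩ := h
  exact ⟨hp, F, hF, hk.trans hkF, τ, hτ.mono (by exact_mod_cast hM), fun i hi => hs i (hM hi)⟩

variable [DecidableEq V] [DecidableEq ι]

theorem Position.IsFresh.update {P Q : Position V ι K} {U : Finset V} {F F' : Finset (Fin K)}
    (h : P.IsFresh U F) (v : V) (m : Status K) (hm : m ≠ Status.unplayed)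
    (hQ : Q.status = Function.update P.status v m) (hF : F' ⊆ F)
    (hc : ∀ c, m = Status.colour c → c ∉ F') : Q.IsFresh (U.erase v) F' := by
  constructor
  · intro u
    rw [hQ]
    by_cases huv : u = v
    · subst huv; simpa using hm
    · simp [huv, h.mem_iff]
  · intro c hcF u
    rw [hQ]
    by_cases huv : u = v
    · subst huv
      intro he
      rw [Function.update_self] at he
      exact hc c he hcF
    · simpa [huv] using h.unused c (hF hcF) u

theorem Position.Serves.update {P Q : Position V ι K} {F F' : Finset (Fin K)} {A A' : V → Prop}
    {x : ι ⊕ Fin K} (h : P.Serves G D F A x) {v : V} {m : Status K}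
    (hQ : Q.status = Function.update P.status v m) (hF : F' ⊆ F) (hA : ∀ u, A' u → A u)
    (hi : ∀ t, x = Sum.inl t → t ∈ Q.marked)
    (hm : ∀ c, x = Sum.inr c → m = Status.colour c → ∀ u, A' u → ¬ G.Adj u v) :
    Q.Serves G D F' A' x := by
  cases x with
  | inl t => exact ⟨hi t rfl, fun u hu => h.2 u (hA u hu)⟩
  | inr c =>
    refine ⟨fun hc => h.1 (hF hc), fun u hu w hw => ?_⟩
    rw [hQ]
    by_cases hwv : w = v
    · subst hwv
      rw [Function.update_self]
      exact fun he => hm c rfl he u hu hw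
    · simpa [hwv] using h.2 u (hA u hu) w hw

/-- Every move of Breaker plays a vertex, and removes at most one class not containing it. -/
theorem Move.breaker_cases {P Q : Position V ι K} (h : Move G D P Player.breaker Q) :
    ∃ v m, P.status v = Status.unplayed ∧ m ≠ Status.unplayed ∧
      Q.status = Function.update P.status v m ∧
      (∀ c, m = Status.colour c → P.CanColour G v c) ∧
      (Q.marked = P.marked ∨ (m = Status.blank ∧ ∃ i, v ∉ D i ∧ Q.marked = P.marked.erase i)) := by
  cases h with
  | colour player v c h =>
    exact ⟨v, _, h.1, by simp, rfl, fun c' hc' => by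
      rw [Status.colour.injEq] at hc'; subst hc'; exact h, Or.inl rfl⟩
  | breakerBlank v h => exact ⟨v, Status.blank, h, by simp, rfl, by simp, Or.inl rfl⟩
  | breakerBlankUnmark v h i hi hv =>
    exact ⟨v, Status.blank, h, by simp, rfl, by simp, Or.inr ⟨rfl, i, hv, rfl⟩⟩

/-- With `player` to move, Maker wins from every position realising the data. -/
def Wins (G : SimpleGraph V) (D : ι → Finset V) (K : ℕ) (player : Player) (U : Finset V)
    (f : V → ℕ) (M : Finset ℕ) (k : ℕ) : Prop :=
  ∀ P : Position V ι K, P.Realises G D U f M k → MakerWinsFrom G D player P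

variable {U : Finset V} {f : V → ℕ} {M : Finset ℕ} {k : ℕ} {player : Player}

theorem Wins.mono {M' : Finset ℕ} {k' : ℕ} (h : Wins G D K player U f M k) (hM : M ⊆ M')
    (hk : k ≤ k') : Wins G D K player U f M' k' := fun P hP => h P (hP.mono hM hk)

theorem wins_empty : Wins G D K player ∅ f M k := by
  rintro P ⟨-, F, hF, -⟩
  refine MakerWinsFrom.filled _ _ fun v hv => ?_
  simpa using (hF.mem_iff v).2 hv

/-- The new colour occurs only at `v`, and the class of `v` is independent, so the colour serves the
rest of that class. -/
theorem Wins.maker_colour {v : V} (hv : v ∈ U) (hk : 1 ≤ k)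
    (h : Wins G D K Player.breaker (U.erase v) f (insert (f v) M) (k - 1)) :
    Wins G D K Player.maker U f M k := by
  rintro P ⟨hp, F, hF, hkF, τ, hτ, hs⟩
  obtain ⟨c, hc⟩ : F.Nonempty := card_pos.1 (by omega)
  have hcan : P.CanColour G v c := ⟨(hF.mem_iff v).1 hv, fun w _ => hF.unused c hc w⟩
  refine MakerWinsFrom.maker P _ (fun hE => hE.1 v c hcan) (Move.colour _ v c hcan) (h _ ?_)
  refine ⟨hp.mono (erase_subset _ _), F.erase c, hF.update v _ (by simp) rfl (erase_subset _ _)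
    (fun c' hc' => by rw [Status.colour.injEq] at hc'; subst hc'; simp), ?_, ?_⟩
  · rw [card_erase_of_mem hc]; omega
  by_cases hfv : f v ∈ M
  · rw [insert_eq_of_mem hfv]
    refine ⟨τ, hτ, fun i hi => (hs i hi).update rfl (erase_subset _ _)
      (fun u hu => ⟨mem_of_mem_erase hu.1, hu.2⟩) ?_ ?_⟩
    · intro t ht
      have := hs i hi
      rw [ht] at this
      exact this.1
    · intro c' hc' hcc
      rw [Status.colour.injEq] at hcc
      subst hcc
      have := hs i hi
      rw [hc'] at this
      exact absurd hc this.1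
  · refine ⟨Function.update τ (f v) (Sum.inr c), ?_, ?_⟩
    · rw [coe_insert, Set.injOn_insert (by exact_mod_cast hfv)]
      refine ⟨?_, ?_⟩
      · intro a ha b hb hab
        have ha' : a ≠ f v := fun e => hfv (e ▸ ha)
        have hb' : b ≠ f v := fun e => hfv (e ▸ hb)
        rw [Function.update_of_ne ha', Function.update_of_ne hb'] at hab
        exact hτ ha hb hab
      · rintro ⟨a, ha, hab⟩
        have ha' : a ≠ f v := fun e => hfv (e ▸ ha)
        rw [Function.update_of_ne ha', Function.update_self] at hab
        have := hs a (by exact_mod_cast ha)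
        rw [hab] at this
        exact this.1 hc
    · intro i hi
      by_cases hiv : i = f v
      · subst hiv
        rw [Function.update_self]
        refine ⟨by simp, fun u hu w hw => ?_⟩
        show Function.update P.status v _ w ≠ _
        by_cases hwv : w = v
        · subst hwv
          exact absurd hw (hp u (mem_of_mem_erase hu.1) _ hv hu.2)
        · simpa [hwv] using hF.unused c hc w
      · have hiM : i ∈ M := (mem_insert.1 hi).resolve_left hiv
        rw [Function.update_of_ne hiv]
        refine (hs i hiM).update rfl (erase_subset _ _)
          (fun u hu => ⟨mem_of_mem_erase hu.1, hu.2⟩) ?_ ?_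
        · intro t ht
          have := hs i hiM
          rw [ht] at this
          exact this.1
        · intro c' hc' hcc
          rw [Status.colour.injEq] at hcc
          subst hcc
          have := hs i hiM
          rw [hc'] at this
          exact absurd hc this.1

/-- The move is a blank or an old colour, according to what serves the class. An old colour stays
usable on the rest of the class by independence, and by injectivity of `τ` it serves no other label
of `M`, so no mark is lost. -/
theorem Wins.maker_blank {v : V} (hv : v ∈ U) (hM : f v ∈ M)
    (h : Wins G D K Player.breaker (U.erase v) f M k) : Wins G D K Player.maker U f M k := by
  rintro P ⟨hp, F, hF, hkF, τ, hτ, hs⟩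
  have hserve := hs _ hM
  have key : ∀ Q : Position V ι K, ∀ m, m ≠ Status.unplayed →
      Q.status = Function.update P.status v m → Q.marked = P.marked →
      (∀ c, m = Status.colour c → τ (f v) = Sum.inr c) → MakerWinsFrom G D Player.breaker Q := by
    intro Q m hm hQ hQm hc
    refine h Q ⟨hp.mono (erase_subset _ _), F, hF.update v m hm hQ subset_rfl ?_, hkF, τ, hτ, ?_⟩
    · intro c hmc
      have h1 := hc c hmc
      rw [h1] at hserve
      exact hserve.1
    · intro i hi
      refine (hs i hi).update hQ subset_rfl (fun u hu => ⟨mem_of_mem_erase hu.1, hu.2⟩) ?_ ?_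
      · intro t ht
        have := hs i hi
        rw [ht] at this
        rw [hQm]
        exact this.1
      · intro c hτi hmc u hu
        have : i = f v := hτ hi hM (hτi.trans (hc c hmc).symm)
        exact hp u (mem_of_mem_erase hu.1) v hv (hu.2.trans this)
  cases hx : τ (f v) with
  | inl t =>
    rw [hx] at hserve
    have hop : P.OpenForBlank D v :=
      ⟨(hF.mem_iff v).1 hv, t, hserve.1, hserve.2 v ⟨hv, rfl⟩⟩
    exact MakerWinsFrom.maker P _ (fun hE => hE.2 v hop) (Move.makerBlank v hop)
      (key _ Status.blank (by simp) rfl rfl (by simp))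
  | inr c =>
    rw [hx] at hserve
    have hcan : P.CanColour G v c := ⟨(hF.mem_iff v).1 hv, hserve.2 v ⟨hv, rfl⟩⟩
    refine MakerWinsFrom.maker P _ (fun hE => hE.1 v c hcan) (Move.colour _ v c hcan)
      (key _ (Status.colour c) (by simp) rfl rfl ?_)
    intro c' hc'
    rw [Status.colour.injEq] at hc'
    rw [← hc', hx]

/-- A blank removes at most one marked class, and an old colour serves at most one label since `τ`
is injective; hence a reply without an unused colour spoils at most one label. It is never the label
of the vertex played, because a removed class avoids that vertex and an old colour does no harm
inside an independent class. The condition `hE` ensures that the game has not ended unless it is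
won. -/
theorem Wins.breaker (hE : U = ∅ ∨ (U.Nonempty ∧ 1 ≤ k) ∨ ∃ v ∈ U, f v ∈ M)
    (h₁ : ∀ v ∈ U, 1 ≤ k → Wins G D K Player.maker (U.erase v) f (insert (f v) M) (k - 1))
    (h₂ : ∀ v ∈ U, ∀ i, i ≠ f v → Wins G D K Player.maker (U.erase v) f (M.erase i) k) :
    Wins G D K Player.breaker U f M k := by
  rcases hE with rfl | hE
  · exact wins_empty
  rintro P ⟨hp, F, hF, hkF, τ, hτ, hs⟩
  refine MakerWinsFrom.breaker P ?_ ?_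
  · intro hend
    rcases hE with ⟨⟨v, hv⟩, hk⟩ | ⟨v, hv, hvM⟩
    · obtain ⟨c, hc⟩ : F.Nonempty := card_pos.1 (by omega)
      exact hend.1 v c ⟨(hF.mem_iff v).1 hv, fun w _ => hF.unused c hc w⟩
    · have hserve := hs _ hvM
      cases hx : τ (f v) with
      | inl t =>
        rw [hx] at hserve
        exact hend.2 v ⟨(hF.mem_iff v).1 hv, t, hserve.1, hserve.2 v ⟨hv, rfl⟩⟩
      | inr c =>
        rw [hx] at hserve
        exact hend.1 v c ⟨(hF.mem_iff v).1 hv, hserve.2 v ⟨hv, rfl⟩⟩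
  intro Q hQ
  obtain ⟨v, m, hv, hm, hst, hcol, hmk⟩ := hQ.breaker_cases
  have hvU : v ∈ U := (hF.mem_iff v).2 hv
  by_cases hfresh : ∃ c ∈ F, m = Status.colour c
  · obtain ⟨c, hc, rfl⟩ := hfresh
    have hmk' : Q.marked = P.marked := hmk.resolve_right (by simp)
    have hk1 : 1 ≤ #F := card_pos.2 ⟨c, hc⟩
    have hold : ∀ i ∈ M, Q.Serves G D (F.erase c) (fun u => u ∈ U.erase v ∧ f u = i) (τ i) := by
      intro i hi
      refine (hs i hi).update hst (erase_subset _ _) (fun u hu => ⟨mem_of_mem_erase hu.1, hu.2⟩)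
        ?_ ?_
      · intro t ht
        have := hs i hi
        rw [ht] at this
        rw [hmk']
        exact this.1
      · intro c' hc' hcc
        rw [Status.colour.injEq] at hcc
        subst hcc
        have := hs i hi
        rw [hc'] at this
        exact absurd hc this.1
    have hfr : Q.IsFresh (U.erase v) (F.erase c) := hF.update v _ (by simp) hst (erase_subset _ _)
      (fun c' hc' => by rw [Status.colour.injEq] at hc'; subst hc'; simp)
    -- As `k` is only a lower bound, an unused colour may exist although `k = 0`. Such a reply is
    -- treated as one that spends nothing, with `f v + 1` as a dummy spoiled label.
    rcases Nat.eq_zero_or_pos k with rfl | hk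
    · exact h₂ v hvU (f v + 1) (by omega) Q ⟨hp.mono (erase_subset _ _), F.erase c, hfr,
        Nat.zero_le _, τ, hτ.mono (by simp), fun i hi => hold i (mem_of_mem_erase hi)⟩
    refine h₁ v hvU hk Q ⟨hp.mono (erase_subset _ _), F.erase c, hfr, ?_, ?_⟩
    · rw [card_erase_of_mem hc]; omega
    by_cases hfv : f v ∈ M
    · rw [insert_eq_of_mem hfv]
      exact ⟨τ, hτ, hold⟩
    refine ⟨Function.update τ (f v) (Sum.inr c), ?_, ?_⟩
    · rw [coe_insert, Set.injOn_insert (by exact_mod_cast hfv)]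
      refine ⟨?_, ?_⟩
      · intro a ha b hb hab
        have ha' : a ≠ f v := fun e => hfv (e ▸ ha)
        have hb' : b ≠ f v := fun e => hfv (e ▸ hb)
        rw [Function.update_of_ne ha', Function.update_of_ne hb'] at hab
        exact hτ ha hb hab
      · rintro ⟨a, ha, hab⟩
        have ha' : a ≠ f v := fun e => hfv (e ▸ ha)
        rw [Function.update_of_ne ha', Function.update_self] at hab
        have := hs a (by exact_mod_cast ha)
        rw [hab] at this
        exact this.1 hc
    · intro i hi
      by_cases hiv : i = f v
      · subst hiv
        rw [Function.update_self]
        refine ⟨by simp, fun u hu w hw => ?_⟩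
        rw [hst]
        by_cases hwv : w = v
        · subst hwv
          exact absurd hw (hp u (mem_of_mem_erase hu.1) _ hvU hu.2)
        · simpa [hwv] using hF.unused c hc w
      · rw [Function.update_of_ne hiv]
        exact hold i ((mem_insert.1 hi).resolve_left hiv)
  · have hfr : Q.IsFresh (U.erase v) F := hF.update v m hm hst subset_rfl
      (fun c hc hcF => hfresh ⟨c, hcF, hc⟩)
    -- the label that Breaker's reply may spoil
    obtain ⟨j, hj, hjs⟩ : ∃ j, j ≠ f v ∧ ∀ i ∈ M, i ≠ j →
        Q.Serves G D F (fun u => u ∈ U.erase v ∧ f u = i) (τ i) := by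
      have gen : ∀ i ∈ M, (∀ t, τ i = Sum.inl t → t ∈ Q.marked) →
          (∀ c, τ i = Sum.inr c → m = Status.colour c → i = f v) →
          Q.Serves G D F (fun u => u ∈ U.erase v ∧ f u = i) (τ i) := by
        intro i hi h1 h2
        refine (hs i hi).update hst subset_rfl (fun u hu => ⟨mem_of_mem_erase hu.1, hu.2⟩) h1 ?_
        intro c hc hmc u hu
        exact hp u (mem_of_mem_erase hu.1) v hvU (hu.2.trans (h2 c hc hmc))
      have mk_of : ∀ i ∈ M, ∀ t, τ i = Sum.inl t → t ∈ P.marked := by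
        intro i hi t ht
        have := hs i hi
        rw [ht] at this
        exact this.1
      rcases hmk with hmk | ⟨rfl, t, htv, hmk⟩
      -- If nothing is spoiled, `f v + 1` is again a dummy label different from `f v`.
      · by_cases hbad : ∃ i ∈ M, i ≠ f v ∧ ∃ c, τ i = Sum.inr c ∧ m = Status.colour c
        · obtain ⟨j, hjM, hj, c, hτc, rfl⟩ := hbad
          refine ⟨j, hj, fun i hi hij => gen i hi ?_ ?_⟩
          · intro t ht
            rw [hmk]
            exact mk_of i hi t ht
          · intro c' hc' hcc
            rw [Status.colour.injEq] at hcc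
            subst hcc
            exact absurd (hτ hi hjM (hc'.trans hτc.symm)) hij
        · refine ⟨f v + 1, by omega, fun i hi _ => gen i hi ?_ ?_⟩
          · intro t ht
            rw [hmk]
            exact mk_of i hi t ht
          · intro c' hc' hcc
            by_contra hne
            exact hbad ⟨i, hi, hne, c', hc', hcc⟩
      · by_cases hbad : ∃ i ∈ M, τ i = Sum.inl t
        · obtain ⟨j, hjM, hτj⟩ := hbad
          refine ⟨j, ?_, fun i hi hij => gen i hi ?_ (by simp)⟩
          · rintro rfl
            have := hs _ hjM
            rw [hτj] at this
            exact htv (this.2 v ⟨hvU, rfl⟩)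
          · intro t' ht'
            rw [hmk, mem_erase]
            refine ⟨?_, mk_of i hi t' ht'⟩
            rintro rfl
            exact hij (hτ hi hjM (ht'.trans hτj.symm))
        · refine ⟨f v + 1, by omega, fun i hi _ => gen i hi ?_ (by simp)⟩
          intro t' ht'
          rw [hmk, mem_erase]
          refine ⟨?_, mk_of i hi t' ht'⟩
          rintro rfl
          exact hbad ⟨i, hi, ht'⟩
    refine h₂ v hvU j hj Q ⟨hp.mono (erase_subset _ _), F, hfr, hkF, τ, hτ.mono (by simp), ?_⟩
    intro i hi
    exact hjs i (mem_of_mem_erase hi) (ne_of_mem_erase hi)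

end Positions

/-! ### Wins that follow from counting vertices, classes and unused colours. -/

section Counting

open Finset

variable {V ι : Type*} {K : ℕ} {G : SimpleGraph V} {D : ι → Finset V}
variable [DecidableEq V] [DecidableEq ι]
variable {U : Finset V} {f : V → ℕ} {M : Finset ℕ} {k : ℕ} {player : Player}

theorem card_image_erase_le (U : Finset V) (f : V → ℕ) (v : V) :
    #((U.erase v).image f) ≤ #(U.image f) := card_le_card (image_subset_image (erase_subset _ _))

theorem card_image_lt_of_label_missing {U U' : Finset V} {f : V → ℕ} {v : V} (hU : U' ⊆ U)
    (hv : v ∈ U) (h : ∀ u ∈ U', f u ≠ f v) : #(U'.image f) + 1 ≤ #(U.image f) := by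
  refine card_lt_card ⟨image_subset_image hU, fun hs => ?_⟩
  obtain ⟨u, hu, huv⟩ := mem_image.1 (hs (mem_image_of_mem f hv))
  exact h u hu huv

theorem card_image_erase_of_alone {v : V} (hv : v ∈ U) (h : ∀ u ∈ U, f u = f v → u = v) :
    #((U.erase v).image f) + 1 = #(U.image f) := by
  conv_rhs => rw [← insert_erase hv, image_insert]
  rw [card_insert_of_notMem]
  intro hm
  obtain ⟨u, hu, huv⟩ := mem_image.1 hm
  exact ne_of_mem_erase hu (h u (mem_of_mem_erase hu) huv)

theorem card_image_pos {v : V} (hv : v ∈ U) : 1 ≤ #(U.image f) :=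
  card_pos.2 ⟨_, mem_image_of_mem f hv⟩

theorem exists_label_mem_of_card_image_eq {U U' : Finset V} {v : V} (hU : U' ⊆ U) (hv : v ∈ U)
    (h : #(U.image f) ≤ #(U'.image f)) : ∃ u ∈ U', f u = f v := by
  by_contra! hne
  have := card_image_lt_of_label_missing hU hv hne
  omega

theorem label_eq_of_card_image_le_one (h : #(U.image f) ≤ 1) {u v : V} (hu : u ∈ U) (hv : v ∈ U) :
    f u = f v := card_le_one.1 h _ (mem_image_of_mem f hu) _ (mem_image_of_mem f hv)

/-- The mark could be spoiled only by a move outside the class, and no unplayed vertex is left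
there. -/
theorem wins_of_single_marked {i : ℕ} (hi : i ∈ M) (h : ∀ u ∈ U, f u = i) :
    Wins G D K player U f M k := by
  induction hn : #U generalizing U M k player with
  | zero => rw [card_eq_zero.1 hn]; exact wins_empty
  | succ n ih =>
    obtain ⟨v, hv⟩ : U.Nonempty := card_pos.1 (by omega)
    have step : ∀ w ∈ U, ∀ player' M' k', i ∈ M' → Wins G D K player' (U.erase w) f M' k' :=
      fun w hw player' M' k' hM' => ih hM' (fun u hu => h u (mem_of_mem_erase hu))
        (by rw [card_erase_of_mem hw, hn]; rfl)
    cases player with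
    | maker => exact Wins.maker_blank hv (by rwa [h v hv]) (step v hv _ _ _ hi)
    | breaker =>
      refine Wins.breaker (Or.inr (Or.inr ⟨v, hv, by rwa [h v hv]⟩))
        (fun w hw _ => step w hw _ _ _ (mem_insert_of_mem hi)) (fun w hw j hj => ?_)
      exact step w hw _ _ _ (mem_erase.2 ⟨by rw [← h w hw]; exact hj.symm, hi⟩)

theorem wins_of_card_le (h : #U ≤ k) : Wins G D K player U f M k := by
  induction hn : #U generalizing U M k player with
  | zero => rw [card_eq_zero.1 hn]; exact wins_empty
  | succ n ih =>
    obtain ⟨v, hv⟩ : U.Nonempty := card_pos.1 (by omega)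
    have step : ∀ w ∈ U, ∀ player' M' k', n ≤ k' → Wins G D K player' (U.erase w) f M' k' := by
      intro w hw player' M' k' hk'
      have : #(U.erase w) = n := by rw [card_erase_of_mem hw, hn]; rfl
      exact ih (by omega) this
    cases player with
    | maker => exact Wins.maker_colour hv (by omega) (step v hv _ _ _ (by omega))
    | breaker =>
      exact Wins.breaker (Or.inr (Or.inl ⟨⟨v, hv⟩, by omega⟩))
        (fun w hw _ => step w hw _ _ _ (by omega)) (fun w hw j hj => step w hw _ _ _ (by omega))

theorem wins_of_single {i : ℕ} (hk : 1 ≤ k) (h : ∀ u ∈ U, f u = i) :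
    Wins G D K player U f M k := by
  induction hn : #U generalizing U M k player with
  | zero => rw [card_eq_zero.1 hn]; exact wins_empty
  | succ n ih =>
    obtain ⟨v, hv⟩ : U.Nonempty := card_pos.1 (by omega)
    have h' : ∀ w, ∀ u ∈ U.erase w, f u = i := fun w u hu => h u (mem_of_mem_erase hu)
    cases player with
    | maker =>
      exact Wins.maker_colour hv hk
        (wins_of_single_marked (i := i) (by rw [h v hv]; exact mem_insert_self _ _) (h' v))
    | breaker =>
      refine Wins.breaker (Or.inr (Or.inl ⟨⟨v, hv⟩, hk⟩)) (fun w hw _ => ?_) (fun w hw j hj => ?_)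
      · exact wins_of_single_marked (i := i) (by rw [h w hw]; exact mem_insert_self _ _) (h' w)
      · exact ih hk (h' w) (by rw [card_erase_of_mem hw, hn]; rfl)

theorem exists_alone_of_card_three (h3 : #U = 3) (h2 : #(U.image f) = 2) :
    ∃ v ∈ U, ∃ i, ∀ u ∈ U.erase v, f u = i := by
  obtain ⟨a, b, c, hab, hac, hbc, rfl⟩ := card_eq_three.1 h3
  by_cases h₁ : f a = f b
  · refine ⟨c, by simp, f a, fun u hu => ?_⟩
    simp only [mem_erase, mem_insert, mem_singleton] at hu
    obtain ⟨h0, rfl | rfl | rfl⟩ := hu <;> simp_all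
  by_cases h₂ : f a = f c
  · refine ⟨b, by simp, f a, fun u hu => ?_⟩
    simp only [mem_erase, mem_insert, mem_singleton] at hu
    obtain ⟨h0, rfl | rfl | rfl⟩ := hu <;> simp_all
  by_cases h₃ : f b = f c
  · refine ⟨a, by simp, f b, fun u hu => ?_⟩
    simp only [mem_erase, mem_insert, mem_singleton] at hu
    obtain ⟨h0, rfl | rfl | rfl⟩ := hu <;> simp_all
  · exfalso
    have : #(({a, b, c} : Finset V).image f) = 3 := by
      rw [card_eq_three]
      exact ⟨f a, f b, f c, h₁, h₂, h₃, by simp⟩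
    omega

/-- Without a mark Maker spends a new colour; with one she plays in the marked class for free. If
Breaker spends a colour too, the class in which Maker played is still marked, which gives the second
statement for n - 2, or it has vanished, and then the drop of q gives the first. If Breaker spends
no colour, the drop of ⌊n/2⌋ alone leads to the first statement. -/
theorem wins_weak_and_strong (n : ℕ) (hn : 2 ≤ n) :
    (∀ (U : Finset V) (M : Finset ℕ) (k : ℕ), #U = n → #(U.image f) + n / 2 ≤ k + 1 →
      Wins G D K Player.maker U f M k) ∧
    (∀ (U : Finset V) (M : Finset ℕ) (k : ℕ), #U = n → #(U.image f) + n / 2 ≤ k + 2 →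
      (∃ v ∈ U, f v ∈ M) → Wins G D K Player.maker U f M k) := by
  induction n using Nat.strong_induction_on with
  | _ n ih =>
  constructor
  · intro U M k hU hk
    obtain ⟨v, hv⟩ : U.Nonempty := card_pos.1 (by omega)
    have hq := card_image_pos (f := f) hv
    have hqn : #(U.image f) ≤ #U := card_image_le
    by_cases hq1 : #(U.image f) ≤ 1
    · exact wins_of_single (i := f v) (by omega)
        (fun u hu => label_eq_of_card_image_le_one hq1 hu hv)
    by_cases hnk : n ≤ k
    · exact wins_of_card_le (by omega)
    by_cases h3 : n ≤ 3
    · obtain ⟨x, hx, i, hi⟩ := exists_alone_of_card_three (U := U) (f := f) (by omega) (by omega)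
      exact Wins.maker_colour hx (by omega) (wins_of_single (i := i) (by omega) hi)
    refine Wins.maker_colour hv (by omega) ?_
    have hUv : #(U.erase v) = n - 1 := by rw [card_erase_of_mem hv, hU]
    refine Wins.breaker (Or.inr (Or.inl ⟨card_pos.1 (by omega), by omega⟩)) ?_ ?_
    · intro w hw _
      have hUw : #((U.erase v).erase w) = n - 2 := by rw [card_erase_of_mem hw, hUv]; omega
      have hsub : (U.erase v).erase w ⊆ U := (erase_subset _ _).trans (erase_subset _ _)
      have hq' : #(((U.erase v).erase w).image f) ≤ #(U.image f) :=
        card_le_card (image_subset_image hsub)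
      by_cases hm : ∃ u ∈ (U.erase v).erase w, f u = f v
      · obtain ⟨u, hu, huv⟩ := hm
        exact (ih (n - 2) (by omega) (by omega)).2 _ _ _ hUw (by omega) ⟨u, hu, by simp [huv]⟩
      · have := card_image_lt_of_label_missing hsub hv (by simpa using hm)
        exact (ih (n - 2) (by omega) (by omega)).1 _ _ _ hUw (by omega)
    · intro w hw j hj
      have hUw : #((U.erase v).erase w) = n - 2 := by rw [card_erase_of_mem hw, hUv]; omega
      have hsub : (U.erase v).erase w ⊆ U := (erase_subset _ _).trans (erase_subset _ _)
      have hq' : #(((U.erase v).erase w).image f) ≤ #(U.image f) :=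
        card_le_card (image_subset_image hsub)
      exact (ih (n - 2) (by omega) (by omega)).1 _ _ _ hUw (by omega)
  · rintro U M k hU hk ⟨v, hv, hvM⟩
    have hq := card_image_pos (f := f) hv
    have hqn : #(U.image f) ≤ #U := card_image_le
    have hUv : #(U.erase v) = n - 1 := by rw [card_erase_of_mem hv, hU]
    by_cases hq1 : #(U.image f) ≤ 1
    · exact wins_of_single_marked (i := f v) hvM
        (fun u hu => label_eq_of_card_image_le_one hq1 hu hv)
    by_cases hnk : n ≤ k + 1
    · exact Wins.maker_blank hv hvM (wins_of_card_le (by omega))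
    by_cases h3 : n ≤ 3
    · obtain ⟨x, hx, i, hi⟩ := exists_alone_of_card_three (U := U) (f := f) (by omega) (by omega)
      by_cases hxv : x = v
      · subst hxv
        exact Wins.maker_blank hv hvM (wins_of_single (i := i) (by omega) hi)
      · have := hi v (mem_erase.2 ⟨fun e => hxv e.symm, hv⟩)
        exact Wins.maker_colour hx (by omega)
          (wins_of_single_marked (i := i) (mem_insert_of_mem (this ▸ hvM)) hi)
    refine Wins.maker_blank hv hvM ?_
    refine Wins.breaker (Or.inr (Or.inl ⟨card_pos.1 (by omega), by omega⟩)) ?_ ?_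
    · intro w hw _
      have hUw : #((U.erase v).erase w) = n - 2 := by rw [card_erase_of_mem hw, hUv]; omega
      have hsub : (U.erase v).erase w ⊆ U := (erase_subset _ _).trans (erase_subset _ _)
      have hq' : #(((U.erase v).erase w).image f) ≤ #(U.image f) :=
        card_le_card (image_subset_image hsub)
      by_cases hm : ∃ u ∈ (U.erase v).erase w, f u = f v
      · obtain ⟨u, hu, huv⟩ := hm
        exact (ih (n - 2) (by omega) (by omega)).2 _ _ _ hUw (by omega) ⟨u, hu, by simp [huv, hvM]⟩
      · have := card_image_lt_of_label_missing hsub hv (by simpa using hm)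
        exact (ih (n - 2) (by omega) (by omega)).1 _ _ _ hUw (by omega)
    · intro w hw j hj
      have hUw : #((U.erase v).erase w) = n - 2 := by rw [card_erase_of_mem hw, hUv]; omega
      have hsub : (U.erase v).erase w ⊆ U := (erase_subset _ _).trans (erase_subset _ _)
      have hq' : #(((U.erase v).erase w).image f) ≤ #(U.image f) :=
        card_le_card (image_subset_image hsub)
      exact (ih (n - 2) (by omega) (by omega)).1 _ _ _ hUw (by omega)

theorem wins_weak (hn : 2 ≤ #U) (hk : #(U.image f) + #U / 2 ≤ k + 1) :
    Wins G D K Player.maker U f M k := (wins_weak_and_strong _ hn).1 U M k rfl hk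

theorem wins_strong (hn : 2 ≤ #U) (hk : #(U.image f) + #U / 2 ≤ k + 2) (hM : ∃ v ∈ U, f v ∈ M) :
    Wins G D K Player.maker U f M k := (wins_weak_and_strong _ hn).2 U M k rfl hk hM

/-- Maker wins with Breaker to move, since a reply with a new colour leaves a marked class. -/
theorem wins_breaker (hn : 3 ≤ #U) (hk : #(U.image f) + (#U + 1) / 2 ≤ k + 2) :
    Wins G D K Player.breaker U f M k := by
  obtain ⟨v, hv⟩ : U.Nonempty := card_pos.1 (by omega)
  have hq := card_image_pos (f := f) hv
  refine Wins.breaker (Or.inr (Or.inl ⟨⟨v, hv⟩, by omega⟩)) ?_ ?_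
  · intro w hw _
    have hUw : #(U.erase w) = #U - 1 := by rw [card_erase_of_mem hw]
    have hq' := card_image_erase_le U f w
    by_cases hm : ∃ u ∈ U.erase w, f u = f w
    · obtain ⟨u, hu, huv⟩ := hm
      exact wins_strong (by omega) (by omega) ⟨u, hu, by simp [huv]⟩
    · have := card_image_lt_of_label_missing (erase_subset w U) hw (by simpa using hm)
      exact wins_weak (by omega) (by omega)
  · intro w hw j hj
    have hUw : #(U.erase w) = #U - 1 := by rw [card_erase_of_mem hw]
    have hq' := card_image_erase_le U f w
    exact wins_weak (by omega) (by omega)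

/-- Playing `v` removes a whole class, so q drops at no cost. This gains one over `wins_strong`;
`wins_of_alone` gains one over `wins_weak` in the same way. -/
theorem wins_of_alone_marked {v : V} (hv : v ∈ U) (hvM : f v ∈ M)
    (ha : ∀ u ∈ U, f u = f v → u = v) (hn : 4 ≤ #U) (hk : #(U.image f) + #U / 2 ≤ k + 3) :
    Wins G D K Player.maker U f M k := by
  have hUv : #(U.erase v) = #U - 1 := by rw [card_erase_of_mem hv]
  have hq := card_image_erase_of_alone hv ha
  exact Wins.maker_blank hv hvM (wins_breaker (by omega) (by omega))

theorem wins_of_alone {v : V} (hv : v ∈ U) (ha : ∀ u ∈ U, f u = f v → u = v) (hn : 4 ≤ #U)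
    (hk : #(U.image f) + #U / 2 ≤ k + 2) : Wins G D K Player.maker U f M k := by
  have hUv : #(U.erase v) = #U - 1 := by rw [card_erase_of_mem hv]
  have hq := card_image_erase_of_alone hv ha
  have hq' : 1 ≤ #((U.erase v).image f) := by
    obtain ⟨w, hw⟩ : (U.erase v).Nonempty := card_pos.1 (by omega)
    exact card_image_pos hw
  exact Wins.maker_colour hv (by omega) (wins_breaker (by omega) (by omega))

end Counting

/-! ### Positions with two marked classes, where the bound improves to k + 3. -/

section TwoMarked

open Finset

variable {V ι : Type*} {K : ℕ} {G : SimpleGraph V} {D : ι → Finset V}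
variable [DecidableEq V] [DecidableEq ι]
variable {U : Finset V} {f : V → ℕ} {M : Finset ℕ} {k : ℕ} {player : Player}

/-- The vertices of `U` with label `i`. -/
def labelClass (U : Finset V) (f : V → ℕ) (i : ℕ) : Finset V := U.filter (fun u => f u = i)

theorem mem_labelClass {i : ℕ} {u : V} : u ∈ labelClass U f i ↔ u ∈ U ∧ f u = i := by
  simp [labelClass]

theorem card_labelClass_erase_self {v : V} (hv : v ∈ U) :
    #(labelClass (U.erase v) f (f v)) + 1 = #(labelClass U f (f v)) := by
  have : labelClass (U.erase v) f (f v) = (labelClass U f (f v)).erase v := by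
    ext u; simp only [mem_labelClass, mem_erase]; tauto
  rw [this]
  exact card_erase_add_one (mem_labelClass.2 ⟨hv, rfl⟩)

theorem labelClass_erase_of_ne {i : ℕ} {v : V} (hi : f v ≠ i) :
    labelClass (U.erase v) f i = labelClass U f i := by
  ext u
  simp only [mem_labelClass, mem_erase]
  refine ⟨fun h => ⟨h.1.2, h.2⟩, fun h => ⟨⟨?_, h.1⟩, h.2⟩⟩
  rintro rfl
  exact hi h.2

theorem card_labelClass_add_le {i j : ℕ} (hij : i ≠ j) :
    #(labelClass U f i) + #(labelClass U f j) ≤ #U := by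
  rw [← card_union_of_disjoint]
  · exact card_le_card (union_subset (filter_subset _ _) (filter_subset _ _))
  · rw [disjoint_left]
    intro u hi hj
    exact hij ((mem_labelClass.1 hi).2.symm.trans (mem_labelClass.1 hj).2)

theorem card_eq_of_two_labels {i j : ℕ} (hij : i ≠ j) (h : ∀ u ∈ U, f u = i ∨ f u = j) :
    #U = #(labelClass U f i) + #(labelClass U f j) := by
  refine le_antisymm ?_ (card_labelClass_add_le hij)
  refine (card_le_card ?_).trans (card_union_le _ _)
  intro u hu
  rcases h u hu with h | h
  · exact mem_union_left _ (mem_labelClass.2 ⟨hu, h⟩)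
  · exact mem_union_right _ (mem_labelClass.2 ⟨hu, h⟩)

theorem card_image_le_two {i j : ℕ} (h : ∀ u ∈ U, f u = i ∨ f u = j) : #(U.image f) ≤ 2 := by
  refine (card_le_card (t := {i, j}) ?_).trans card_le_two
  intro l hl
  obtain ⟨u, hu, rfl⟩ := mem_image.1 hl
  simpa using h u hu

/-- This is the position after a round in which no colour was spent and the mark of `v` survived:
either its class still has a vertex, or q has dropped. -/
theorem wins_of_subset_of_marked {U' : Finset V} {v : V} (hU : U' ⊆ U) (hc : #U' + 2 = #U)
    (hn : 4 ≤ #U) (hv : v ∈ U) (hM : f v ∈ M) (hk : #(U.image f) + #U / 2 ≤ k + 3) :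
    Wins G D K Player.maker U' f M k := by
  by_cases h : ∃ u ∈ U', f u = f v
  · obtain ⟨u, hu, huv⟩ := h
    have := card_le_card (image_subset_image (f := f) hU)
    exact wins_strong (by omega) (by omega) ⟨u, hu, huv ▸ hM⟩
  · have := card_image_lt_of_label_missing hU hv (by simpa using h)
    exact wins_weak (by omega) (by omega)

theorem erase_erase_subset (U : Finset V) (v w : V) : (U.erase v).erase w ⊆ U :=
  (erase_subset _ _).trans (erase_subset _ _)

theorem card_erase_erase {v w : V} (hv : v ∈ U) (hw : w ∈ U.erase v) :
    #((U.erase v).erase w) + 2 = #U := by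
  rw [← card_erase_add_one hv, ← card_erase_add_one hw]

/-- Maker plays in the smaller class. Replies with new colours keep it strictly smaller, so it is
exhausted first and a single marked class remains. If Breaker spoils one mark, no colour was spent
in the round and the other mark suffices. -/
theorem wins_of_two_labels {i j : ℕ} (hij : i ≠ j) (hi : i ∈ M) (hj : j ∈ M)
    (h : ∀ u ∈ U, f u = i ∨ f u = j) (hpos : 1 ≤ #(labelClass U f i))
    (hlt : #(labelClass U f i) < #(labelClass U f j)) (hk : #U / 2 ≤ k + 1) :
    Wins G D K Player.maker U f M k := by
  induction hn : #(labelClass U f i) using Nat.strong_induction_on generalizing U M k with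
  | _ n ih =>
  subst hn
  obtain ⟨v, hv⟩ := card_pos.1 hpos
  obtain ⟨hvU, rfl⟩ := mem_labelClass.1 hv
  have hcard := card_eq_of_two_labels hij h
  have hq := card_image_le_two h
  have hvi := card_labelClass_erase_self (f := f) hvU
  have hvj := labelClass_erase_of_ne (U := U) hij
  have hUv := card_erase_add_one hvU
  refine Wins.maker_blank hvU hi ?_
  by_cases h1 : #(labelClass U f (f v)) = 1
  · refine wins_of_single_marked hj fun u hu => (h u (mem_of_mem_erase hu)).resolve_left fun hu' => ?_
    have h0 : #(labelClass (U.erase v) f (f v)) = 0 := by omega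
    rw [card_eq_zero] at h0
    have : u ∈ labelClass (U.erase v) f (f v) := mem_labelClass.2 ⟨hu, hu'⟩
    simp [h0] at this
  obtain ⟨y, hy⟩ := card_pos.1 (show 0 < #(labelClass U f j) by omega)
  obtain ⟨hyU, hyj⟩ := mem_labelClass.1 hy
  refine Wins.breaker (Or.inr (Or.inr ⟨y, mem_erase.2 ⟨?_, hyU⟩, hyj ▸ hj⟩)) ?_ ?_
  · rintro rfl; exact hij hyj
  · intro w hw hk1
    have hw2 := card_erase_erase hvU hw
    have hsub := erase_erase_subset U v w
    have hwi := card_labelClass_erase_self (f := f) hw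
    have h' : ∀ u ∈ (U.erase v).erase w, f u = f v ∨ f u = j := fun u hu => h u (hsub hu)
    rcases h w (mem_of_mem_erase hw) with hwv | hwj
    · rw [hwv] at hwi
      have hwj := labelClass_erase_of_ne (U := U.erase v) (f := f) (v := w) (i := j)
        (by rw [hwv]; exact hij)
      rw [hvj] at hwj
      by_cases h2 : #(labelClass U f (f v)) = 2
      · refine wins_of_single_marked (mem_insert_of_mem hj) fun u hu =>
          (h' u hu).resolve_left fun hu' => ?_
        have h0 : #(labelClass ((U.erase v).erase w) f (f v)) = 0 := by omega
        rw [card_eq_zero] at h0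
        have : u ∈ labelClass ((U.erase v).erase w) f (f v) := mem_labelClass.2 ⟨hu, hu'⟩
        simp [h0] at this
      · exact ih _ (by omega) (mem_insert_of_mem hi) (mem_insert_of_mem hj) h' (by omega)
          (by rw [hwj]; omega) (by omega) rfl
    · rw [hwj, hvj] at hwi
      have hwv := labelClass_erase_of_ne (U := U.erase v) (f := f) (v := w) (i := f v)
        (by rw [hwj]; exact hij.symm)
      exact ih _ (by rw [hwv]; omega) (mem_insert_of_mem hi) (mem_insert_of_mem hj) h'
        (by rw [hwv]; omega) (by rw [hwv]; omega) (by omega) rfl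
  · intro w hw l hl
    have hw2 := card_erase_erase hvU hw
    have hsub := erase_erase_subset U v w
    by_cases hli : l = f v
    · exact wins_of_subset_of_marked hsub hw2 (by omega) hyU
        (mem_erase.2 ⟨by rw [hyj, hli]; exact hij.symm, hyj ▸ hj⟩) (by omega)
    · exact wins_of_subset_of_marked hsub hw2 (by omega) hvU
        (mem_erase.2 ⟨fun e => hli e.symm, hi⟩) (by omega)

theorem exists_label_ne_ne (hq : 3 ≤ #(U.image f)) (i j : ℕ) : ∃ u ∈ U, f u ≠ i ∧ f u ≠ j := by
  by_contra! h
  have := card_image_le_two (U := U) (f := f) (i := i) (j := j)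
    (fun u hu => or_iff_not_imp_left.2 (h u hu))
  omega

/-- Maker plays in a marked class. If Breaker spends a colour, either both marked classes remain and
the induction continues, or a class has vanished and one mark is enough. Five vertices are
exceptional because a round leaves only three. -/
theorem wins_of_two_marked {x y : V} (hx : x ∈ U) (hy : y ∈ U) (hxy : f x ≠ f y) (hxM : f x ∈ M)
    (hyM : f y ∈ M) (hq : 3 ≤ #(U.image f)) (hn : 4 ≤ #U)
    (hk : #(U.image f) + #U / 2 ≤ k + 3) : Wins G D K Player.maker U f M k := by
  induction hm : #U using Nat.strong_induction_on generalizing U M k x y with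
  | _ n ih =>
  subst hm
  by_cases hxa : ∀ u ∈ U, f u = f x → u = x
  · exact wins_of_alone_marked hx hxM hxa hn hk
  by_cases hya : ∀ u ∈ U, f u = f y → u = y
  · exact wins_of_alone_marked hy hyM hya hn hk
  push Not at hxa hya
  obtain ⟨x', hx', hxx', hne⟩ := hxa
  obtain ⟨y', hy', hyy', hne'⟩ := hya
  have hcx : 2 ≤ #(labelClass U f (f x)) := by
    rw [← card_pair hne]
    exact card_le_card (by
      intro u hu
      simp only [mem_insert, mem_singleton] at hu
      rcases hu with rfl | rfl
      · exact mem_labelClass.2 ⟨hx', hxx'⟩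
      · exact mem_labelClass.2 ⟨hx, rfl⟩)
  have hcy : 2 ≤ #(labelClass U f (f y)) := by
    rw [← card_pair hne']
    exact card_le_card (by
      intro u hu
      simp only [mem_insert, mem_singleton] at hu
      rcases hu with rfl | rfl
      · exact mem_labelClass.2 ⟨hy', hyy'⟩
      · exact mem_labelClass.2 ⟨hy, rfl⟩)
  obtain ⟨z, hz, hzx, hzy⟩ := exists_label_ne_ne hq (f x) (f y)
  have hUz := card_erase_add_one hz
  have hsum := card_labelClass_add_le (U := U.erase z) (f := f) hxy
  rw [labelClass_erase_of_ne hzx, labelClass_erase_of_ne hzy] at hsum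
  have hmem : ∀ {u a : V}, u ∈ U → f a ≠ f u → u ∈ U.erase a := fun {u a} hu hau =>
    mem_erase.2 ⟨by rintro rfl; exact hau rfl, hu⟩
  by_cases h5 : #U = 5
  · -- the sizes of the classes are 2, 2 and 1
    have h2 : ∀ u ∈ U.erase z, f u = f x ∨ f u = f y := by
      have hun : labelClass (U.erase z) f (f x) ∪ labelClass (U.erase z) f (f y) = U.erase z := by
        refine eq_of_subset_of_card_le (union_subset (filter_subset _ _) (filter_subset _ _)) ?_
        rw [card_union_of_disjoint, labelClass_erase_of_ne hzx, labelClass_erase_of_ne hzy]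
        · omega
        · rw [disjoint_left]
          intro u hi hj
          exact hxy ((mem_labelClass.1 hi).2.symm.trans (mem_labelClass.1 hj).2)
      intro u hu
      rw [← hun, mem_union, mem_labelClass, mem_labelClass] at hu
      tauto
    have hcx' := labelClass_erase_of_ne (U := U) hzx
    have hcy' := labelClass_erase_of_ne (U := U) hzy
    have hq2 := card_image_le_two h2
    -- Colouring the singleton class leaves two marked pairs, and any reply with a new colour makes
    -- their sizes 1 and 2, as `wins_of_two_labels` needs.
    refine Wins.maker_colour hz (by omega) ?_
    refine Wins.breaker (Or.inr (Or.inr ⟨x, hmem hx hzx, mem_insert_of_mem hxM⟩)) ?_ ?_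
    · intro w hw hk1
      have hw2 := card_erase_erase hz hw
      have hwi := card_labelClass_erase_self (f := f) hw
      have h' : ∀ u ∈ (U.erase z).erase w, f u = f x ∨ f u = f y :=
        fun u hu => h2 u (mem_of_mem_erase hu)
      have hxM' : f x ∈ insert (f w) (insert (f z) M) :=
        mem_insert_of_mem (mem_insert_of_mem hxM)
      have hyM' : f y ∈ insert (f w) (insert (f z) M) :=
        mem_insert_of_mem (mem_insert_of_mem hyM)
      rcases h2 w hw with hwx | hwy
      · have hwj := labelClass_erase_of_ne (U := U.erase z) (f := f) (v := w) (i := f y)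
          (by rw [hwx]; exact hxy)
        rw [hwx, hcx'] at hwi
        rw [hcy'] at hwj
        exact wins_of_two_labels hxy hxM' hyM' h' (by omega) (by rw [hwj]; omega) (by omega)
      · have hwj := labelClass_erase_of_ne (U := U.erase z) (f := f) (v := w) (i := f x)
          (by rw [hwy]; exact hxy.symm)
        rw [hwy, hcy'] at hwi
        rw [hcx'] at hwj
        exact wins_of_two_labels hxy.symm hyM' hxM' (fun u hu => (h' u hu).symm) (by omega)
          (by rw [hwj]; omega) (by omega)
    · intro w hw l hl
      have hw2 := card_erase_erase hz hw
      have hq' := card_le_card (image_subset_image (f := f) (erase_subset w (U.erase z)))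
      have hin : ∀ a ∈ U.erase z, #(labelClass U f (f a)) = 2 →
          f a ∈ M → f a ≠ l → ∃ v ∈ (U.erase z).erase w, f v ∈ (insert (f z) M).erase l := by
        intro a haU hc haM hal
        have hza : f z ≠ f a := by rcases h2 a haU with h | h <;> rw [h] <;> assumption
        have hpos : 0 < #((labelClass U f (f a)).erase w) := by
          have := pred_card_le_card_erase (s := labelClass U f (f a)) (a := w)
          omega
        obtain ⟨b, hb⟩ := card_pos.1 hpos
        obtain ⟨hbw, hb⟩ := mem_erase.1 hb
        obtain ⟨hbU, hba⟩ := mem_labelClass.1 hb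
        exact ⟨b, mem_erase.2 ⟨hbw, hmem hbU (by rw [hba]; exact hza)⟩,
          mem_erase.2 ⟨by rw [hba]; exact hal, mem_insert_of_mem (hba ▸ haM)⟩⟩
      refine wins_strong (by omega) (by omega) ?_
      by_cases hlx : f x = l
      · exact hin y (hmem hy hzy) (by omega) hyM (by rw [← hlx]; exact hxy.symm)
      · exact hin x (hmem hx hzx) (by omega) hxM hlx
  refine Wins.maker_blank hx hxM ?_
  refine Wins.breaker (Or.inr (Or.inr ⟨y, hmem hy hxy, hyM⟩)) ?_ ?_
  · intro w hw hk1
    have hw2 := card_erase_erase hx hw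
    have hsub := erase_erase_subset U x w
    obtain ⟨b, hb, hby⟩ : ∃ b ∈ (U.erase x).erase w, f b = f y := by
      by_cases hwy : y = w
      · subst hwy
        exact ⟨y', mem_erase.2 ⟨hne', hmem hy' (by rw [hyy']; exact hxy)⟩, hyy'⟩
      · exact ⟨y, mem_erase.2 ⟨hwy, hmem hy hxy⟩, rfl⟩
    have hbM : f b ∈ insert (f w) M := mem_insert_of_mem (hby ▸ hyM)
    have hqle := card_le_card (image_subset_image (f := f) hsub)
    by_cases hq' : #(U.image f) ≤ #(((U.erase x).erase w).image f)
    · obtain ⟨a, ha, hax⟩ := exists_label_mem_of_card_image_eq hsub hx hq'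
      exact ih _ (by omega) ha hb (by rw [hax, hby]; exact hxy)
        (mem_insert_of_mem (hax ▸ hxM)) hbM (by omega) (by omega) (by omega) rfl
    · exact wins_strong (by omega) (by omega) ⟨b, hb, hbM⟩
  · intro w hw l hl
    have hw2 := card_erase_erase hx hw
    have hsub := erase_erase_subset U x w
    by_cases hlx : l = f x
    · exact wins_of_subset_of_marked hsub hw2 (by omega) hy
        (mem_erase.2 ⟨by rw [hlx]; exact hxy.symm, hyM⟩) hk
    · exact wins_of_subset_of_marked hsub hw2 (by omega) hx
        (mem_erase.2 ⟨fun e => hlx e.symm, hxM⟩) hk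

end TwoMarked

/-! ### One round with a new partition afterwards, and positions in which every vertex is safe. -/

section Rounds

open Finset

variable {V ι : Type*} {K : ℕ} {G : SimpleGraph V} {D : ι → Finset V}
variable [DecidableEq V] [DecidableEq ι]
variable {U : Finset V} {f : V → ℕ} {M : Finset ℕ} {k : ℕ} {player : Player}

/-- Maker gives `v` the unused colour `c`, and has an answer to each reply of Breaker. -/
theorem makerWinsFrom_of_replies {P : Position V ι K} {F : Finset (Fin K)} {v : V} {c : Fin K}
    (hF : P.IsFresh U F) (hv : v ∈ U) (hc : c ∈ F) (hF2 : 2 ≤ #F) (hn : 2 ≤ #U)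
    (h₁ : ∀ w ∈ U.erase v, ∀ c' ∈ F.erase c, ∀ Q : Position V ι K,
      Q.status = Function.update (Function.update P.status v (Status.colour c)) w
        (Status.colour c') → MakerWinsFrom G D Player.maker Q)
    (h₂ : ∀ w ∈ U.erase v, ∀ m, m ≠ Status.unplayed → (∀ c' ∈ F.erase c, m ≠ Status.colour c') →
      (m = Status.colour c → ¬ G.Adj v w) → ∀ Q : Position V ι K,
      Q.status = Function.update (Function.update P.status v (Status.colour c)) w m →
        MakerWinsFrom G D Player.maker Q) :
    MakerWinsFrom G D Player.maker P := by
  have hcan : P.CanColour G v c := ⟨(hF.mem_iff v).1 hv, fun w _ => hF.unused c hc w⟩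
  have hR : (P.play v (Status.colour c)).IsFresh (U.erase v) (F.erase c) :=
    hF.update v _ (by simp) rfl (erase_subset _ _)
      (fun c' hc' => by rw [Status.colour.injEq] at hc'; subst hc'; simp)
  refine MakerWinsFrom.maker P _ (fun hE => hE.1 v c hcan) (Move.colour _ v c hcan) ?_
  refine MakerWinsFrom.breaker _ ?_ ?_
  · intro hend
    obtain ⟨c', hc'⟩ : (F.erase c).Nonempty := card_pos.1 (by rw [card_erase_of_mem hc]; omega)
    obtain ⟨u, hu⟩ : (U.erase v).Nonempty := card_pos.1 (by rw [card_erase_of_mem hv]; omega)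
    exact hend.1 u c' ⟨(hR.mem_iff u).1 hu, fun w _ => hR.unused c' hc' w⟩
  · intro Q hQ
    obtain ⟨w, m, hw, hm, hst, hcol, -⟩ := hQ.breaker_cases
    have hwU := (hR.mem_iff w).2 hw
    by_cases hfresh : ∃ c' ∈ F.erase c, m = Status.colour c'
    · obtain ⟨c', hc', rfl⟩ := hfresh
      exact h₁ w hwU c' hc' Q hst
    · push Not at hfresh
      refine h₂ w hwU m hm hfresh ?_ Q hst
      intro hmc hadj
      refine (hcol c hmc).2 v hadj.symm ?_
      show Function.update P.status v _ v = _
      simp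

/-- Maker gives `v` a new colour. After Breaker's reply, Maker may choose a new partition of the
unplayed vertices, in which the classes avoiding the neighbourhoods of the played vertices count as
marked. -/
theorem Wins.round {v : V} (hv : v ∈ U) (hk : 2 ≤ k) (hn : 2 ≤ #U)
    (h₁ : ∀ w ∈ U.erase v, ∃ (f' : V → ℕ) (i j : ℕ), ProperOn G ((U.erase v).erase w) f' ∧
      i ≠ j ∧ (∀ u ∈ (U.erase v).erase w, f' u = i → ¬ G.Adj u v) ∧
      (∀ u ∈ (U.erase v).erase w, f' u = j → ¬ G.Adj u w) ∧
      Wins G D K Player.maker ((U.erase v).erase w) f' {i, j} (k - 2))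
    (h₂ : ∀ w ∈ U.erase v, ∃ (f' : V → ℕ) (i : ℕ), ProperOn G ((U.erase v).erase w) f' ∧
      (∀ u ∈ (U.erase v).erase w, f' u = i → ¬ G.Adj u v) ∧
      (¬ G.Adj v w → ∀ u ∈ (U.erase v).erase w, f' u = i → ¬ G.Adj u w) ∧
      Wins G D K Player.maker ((U.erase v).erase w) f' {i} (k - 1)) :
    Wins G D K Player.maker U f M k := by
  rintro P ⟨-, F, hF, hkF, -⟩
  obtain ⟨c, hc⟩ : F.Nonempty := card_pos.1 (by omega)
  have hcF := card_erase_add_one hc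
  have hR : ∀ Q : Position V ι K, Q.status = Function.update P.status v (Status.colour c) →
      Q.IsFresh (U.erase v) (F.erase c) := fun Q hQ =>
    hF.update v _ (by simp) hQ (erase_subset _ _)
      (fun c' hc' => by rw [Status.colour.injEq] at hc'; subst hc'; simp)
  refine makerWinsFrom_of_replies hF hv hc (by omega) hn ?_ ?_
  · intro w hw c' hc' Q hQ
    obtain ⟨f', i, j, hp, hij, hi, hj, hW⟩ := h₁ w hw
    have hcF' := card_erase_add_one hc'
    have hne : c' ≠ c := ne_of_mem_erase hc'
    refine hW Q ⟨hp, (F.erase c).erase c', ?_, by omega,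
      fun l => if l = i then Sum.inr c else Sum.inr c', ?_, ?_⟩
    · exact (hR (P.play v (Status.colour c)) rfl).update w _ (by simp) hQ (erase_subset _ _)
        (fun d hd => by rw [Status.colour.injEq] at hd; subst hd; simp)
    · intro a ha b hb hab
      simp only [coe_insert, coe_singleton, Set.mem_insert_iff, Set.mem_singleton_iff] at ha hb
      rcases ha with rfl | rfl <;> rcases hb with rfl | rfl <;>
        simp_all [hij.symm, hne.symm]
    · intro l hl
      simp only [mem_insert, mem_singleton] at hl
      rcases hl with rfl | rfl
      · beta_reduce
        rw [if_pos rfl]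
        refine ⟨by simp, fun u hu x hx hxc => ?_⟩
        rw [hQ] at hxc
        by_cases hxw : x = w
        · subst hxw
          rw [Function.update_self, Status.colour.injEq] at hxc
          exact hne hxc
        by_cases hxv : x = v
        · subst hxv
          exact hi u hu.1 hu.2 hx
        · rw [Function.update_of_ne hxw, Function.update_of_ne hxv] at hxc
          exact hF.unused c hc x hxc
      · beta_reduce
        rw [if_neg hij.symm]
        refine ⟨by simp, fun u hu x hx hxc => ?_⟩
        rw [hQ] at hxc
        by_cases hxw : x = w
        · subst hxw
          exact hj u hu.1 hu.2 hx
        by_cases hxv : x = v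
        · subst hxv
          rw [Function.update_of_ne hxw, Function.update_self, Status.colour.injEq] at hxc
          exact hne hxc.symm
        · rw [Function.update_of_ne hxw, Function.update_of_ne hxv] at hxc
          exact hF.unused c' (mem_of_mem_erase hc') x hxc
  · intro w hw m hm hmF hmc Q hQ
    obtain ⟨f', i, hp, hi, hi', hW⟩ := h₂ w hw
    refine hW Q ⟨hp, F.erase c, ?_, by omega, fun _ => Sum.inr c, by simp, ?_⟩
    · exact (hR (P.play v (Status.colour c)) rfl).update w _ hm hQ subset_rfl
        (fun d hd hdF => hmF d hdF hd)
    · intro l hl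
      rw [mem_singleton] at hl
      subst hl
      refine ⟨by simp, fun u hu x hx hxc => ?_⟩
      rw [hQ] at hxc
      by_cases hxw : x = w
      · subst hxw
        rw [Function.update_self] at hxc
        exact hi' (hmc hxc) u hu.1 hu.2 hx
      by_cases hxv : x = v
      · subst hxv
        exact hi u hu.1 hu.2 hx
      · rw [Function.update_of_ne hxw, Function.update_of_ne hxv] at hxc
        exact hF.unused c hc x hxc

open Classical in
/-- The unplayed vertex `u` will always have a colour available: either it has few neighbours that
may still spoil a colour, or no neighbour can ever get a certain colour. -/
def Position.Safe (P : Position V ι K) (G : SimpleGraph V) (U : Finset V) (F : Finset (Fin K))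
    (u : V) : Prop :=
  #(U.filter (G.Adj u)) + #(F.filter (fun c => ∃ w, G.Adj u w ∧ P.status w = Status.colour c)) < #F
  ∨ ∃ c, (∀ w, G.Adj u w → P.status w ≠ Status.colour c) ∧
      ∀ w ∈ U, G.Adj u w → ∃ z, G.Adj w z ∧ P.status z = Status.colour c

/-- A move at a neighbour of `u` lowers the number of unplayed neighbours by one and raises the
number of colours of `F` around `u` by at most one. In the second alternative the colour stays
forbidden at all unplayed neighbours of `u`. -/
theorem Position.Safe.update {P Q : Position V ι K} {F : Finset (Fin K)} {u v : V} {m : Status K}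
    (hU : ∀ v, v ∈ U ↔ P.status v = Status.unplayed) (h : P.Safe G U F u)
    (hv : v ∈ U) (hQ : Q.status = Function.update P.status v m)
    (hm : ∀ c, m = Status.colour c → P.CanColour G v c) : Q.Safe G (U.erase v) F u := by
  classical
  have hold : ∀ z c, P.status z = Status.colour c → Q.status z = Status.colour c := by
    intro z c hz
    have : z ≠ v := by
      rintro rfl
      rw [(hU z).1 hv] at hz
      simp at hz
    rw [hQ, Function.update_of_ne this, hz]
  rcases h with h | ⟨c, hc, hcU⟩
  · left
    refine lt_of_le_of_lt ?_ h
    by_cases hadj : G.Adj u v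
    · have h1 : ((U.erase v).filter (G.Adj u)) = (U.filter (G.Adj u)).erase v := by
        ext z; simp only [mem_filter, mem_erase]; tauto
      have h2 := card_erase_add_one (mem_filter.2 ⟨hv, hadj⟩)
      have h3 : #(F.filter (fun c => ∃ w, G.Adj u w ∧ Q.status w = Status.colour c)) ≤
          #(F.filter (fun c => ∃ w, G.Adj u w ∧ P.status w = Status.colour c)) + 1 := by
        cases m with
        | colour d =>
          refine (card_le_card (t := insert d _) ?_).trans (card_insert_le _ _)
          intro c hc
          obtain ⟨hcF, w, hw, hwc⟩ := mem_filter.1 hc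
          rw [hQ] at hwc
          by_cases hwv : w = v
          · subst hwv
            rw [Function.update_self, Status.colour.injEq] at hwc
            exact mem_insert.2 (Or.inl hwc.symm)
          · rw [Function.update_of_ne hwv] at hwc
            exact mem_insert_of_mem (mem_filter.2 ⟨hcF, w, hw, hwc⟩)
        | _ =>
          refine (card_le_card ?_).trans (Nat.le_succ _)
          intro c hc
          obtain ⟨hcF, w, hw, hwc⟩ := mem_filter.1 hc
          rw [hQ] at hwc
          by_cases hwv : w = v
          · subst hwv
            simp at hwc
          · rw [Function.update_of_ne hwv] at hwc
            exact mem_filter.2 ⟨hcF, w, hw, hwc⟩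
      rw [h1]
      omega
    · refine Nat.add_le_add (card_le_card (filter_subset_filter _ (erase_subset _ _)))
        (card_le_card ?_)
      intro c hc
      obtain ⟨hcF, w, hw, hwc⟩ := mem_filter.1 hc
      have hwv : w ≠ v := by rintro rfl; exact hadj hw
      rw [hQ, Function.update_of_ne hwv] at hwc
      exact mem_filter.2 ⟨hcF, w, hw, hwc⟩
  · right
    refine ⟨c, fun w hw hwc => ?_, fun w hw hadj => ?_⟩
    · rw [hQ] at hwc
      by_cases hwv : w = v
      · subst hwv
        rw [Function.update_self] at hwc
        obtain ⟨z, hz, hzc⟩ := hcU w hv hw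
        exact (hm c hwc).2 z hz hzc
      · rw [Function.update_of_ne hwv] at hwc
        exact hc w hw hwc
    · obtain ⟨z, hz, hzc⟩ := hcU w (mem_of_mem_erase hw) hadj
      exact ⟨z, hz, hold z c hzc⟩

/-- A safe vertex has an available colour and every legal move preserves safety, so Maker may colour
the vertices in any order. -/
theorem makerWinsFrom_of_safe {P : Position V ι K} {F : Finset (Fin K)}
    (hU : ∀ v, v ∈ U ↔ P.status v = Status.unplayed) (h : ∀ u ∈ U, P.Safe G U F u) :
    MakerWinsFrom G D player P := by
  classical
  induction hn : #U generalizing U P player with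
  | zero =>
    rw [card_eq_zero] at hn
    exact MakerWinsFrom.filled _ _ fun v hv => by simpa [hn] using (hU v).2 hv
  | succ n ih =>
    obtain ⟨v, hv⟩ : U.Nonempty := card_pos.1 (by omega)
    have step : ∀ (player' : Player) (Q : Position V ι K) (w : V) (m : Status K), w ∈ U →
        m ≠ Status.unplayed → Q.status = Function.update P.status w m →
        (∀ c, m = Status.colour c → P.CanColour G w c) → MakerWinsFrom G D player' Q := by
      intro player' Q w m hw hm hQ hcol
      refine ih (U := U.erase w) ?_
        (fun u hu => (h u (mem_of_mem_erase hu)).update hU hw hQ hcol)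
        (by rw [card_erase_of_mem hw, hn]; rfl)
      intro u
      rw [hQ]
      by_cases huw : u = w
      · subst huw; simpa using hm
      · simp [huw, hU]
    obtain ⟨c, hc⟩ : ∃ c, P.CanColour G v c := by
      rcases h v hv with hlt | ⟨c, hc, -⟩
      · obtain ⟨c, hcF, hc⟩ : ∃ c ∈ F,
            c ∉ F.filter (fun c => ∃ w, G.Adj v w ∧ P.status w = Status.colour c) := by
          by_contra! hall
          have := card_le_card (s := F) hall
          omega
        exact ⟨c, (hU v).1 hv, fun w hw hwc => hc (mem_filter.2 ⟨hcF, w, hw, hwc⟩)⟩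
      · exact ⟨c, (hU v).1 hv, hc⟩
    cases player with
    | maker =>
      exact MakerWinsFrom.maker P _ (fun hE => hE.1 v c hc) (Move.colour _ v c hc)
        (step _ _ v _ hv (by simp) rfl
          (fun d hd => by rw [Status.colour.injEq] at hd; subst hd; exact hc))
    | breaker =>
      refine MakerWinsFrom.breaker P (fun hE => hE.1 v c hc) fun Q hQ => ?_
      obtain ⟨w, m, hw, hm, hst, hcol, -⟩ := hQ.breaker_cases
      exact step _ _ w m ((hU w).2 hw) hm hst hcol

end Rounds

/-! ### Two classes of equal size. -/

section Bipartite

open Finset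

variable {V ι : Type*} {K : ℕ} {G : SimpleGraph V} {D : ι → Finset V}
variable [DecidableEq V] [DecidableEq ι]
variable {U : Finset V} {f : V → ℕ} {M : Finset ℕ} {k : ℕ} {player : Player}

theorem makerWinsFrom_of_replies' {P : Position V ι K} {F : Finset (Fin K)} {v : V} {c : Fin K}
    (hF : P.IsFresh U F) (hv : v ∈ U) (hc : c ∈ F) (hF2 : 2 ≤ #F) (hn : 2 ≤ #U)
    (h : ∀ w ∈ U.erase v, ∀ m, m ≠ Status.unplayed → (m = Status.colour c → ¬ G.Adj v w) →
      ∀ Q : Position V ι K,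
      Q.status = Function.update (Function.update P.status v (Status.colour c)) w m →
        MakerWinsFrom G D Player.maker Q) :
    MakerWinsFrom G D Player.maker P := by
  refine makerWinsFrom_of_replies hF hv hc hF2 hn ?_ ?_
  · intro w hw c' hc' Q hQ
    refine h w hw _ (by simp) (fun hcc => ?_) Q hQ
    rw [Status.colour.injEq] at hcc
    exact absurd hcc (ne_of_mem_erase hc')
  · exact fun w hw m hm _ hmc Q hQ => h w hw m hm hmc Q hQ

/-- After Maker gave `v` the colour `c` and Breaker played `w`, Maker gives `x` the colour `d` and
makes every vertex safe. -/
theorem makerWinsFrom_of_safe_move {P Q : Position V ι K} {F : Finset (Fin K)} {v w x : V}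
    {c d : Fin K} {m : Status K} (hF : P.IsFresh U F) (hw : w ∈ U.erase v)
    (hx : x ∈ (U.erase v).erase w) (hm : m ≠ Status.unplayed)
    (hQ : Q.status = Function.update (Function.update P.status v (Status.colour c)) w m)
    (hd : d ∈ F) (hxv : d = c → ¬ G.Adj x v) (hxw : m = Status.colour d → ¬ G.Adj x w)
    (hs : ∀ u ∈ ((U.erase v).erase w).erase x,
      (∃ (A : Finset V) (B : Finset (Fin K)), #A + #B < #F ∧
        (∀ y ∈ ((U.erase v).erase w).erase x, G.Adj u y → y ∈ A) ∧ (G.Adj u v → c ∈ B) ∧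
        (G.Adj u w → ∀ e ∈ F, m = Status.colour e → e ∈ B) ∧ (G.Adj u x → d ∈ B)) ∨
      (∃ e ∈ F, (e = c → ¬ G.Adj u v) ∧ (m = Status.colour e → ¬ G.Adj u w) ∧
        (e = d → ¬ G.Adj u x) ∧ ∀ y ∈ ((U.erase v).erase w).erase x, G.Adj u y →
          (e = c ∧ G.Adj y v) ∨ (e = d ∧ G.Adj y x))) :
    MakerWinsFrom G D Player.maker Q := by
  classical
  have hwv : w ≠ v := ne_of_mem_erase hw
  have hxw' : x ≠ w := ne_of_mem_erase hx
  have hxv' : x ≠ v := ne_of_mem_erase (mem_of_mem_erase hx)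
  have hxU : x ∈ U := erase_erase_subset _ _ _ hx
  have hQcol : ∀ e ∈ F, ∀ z, Q.status z = Status.colour e →
      (z = v ∧ e = c) ∨ (z = w ∧ m = Status.colour e) := by
    intro e he z hz
    rw [hQ] at hz
    by_cases hzw : z = w
    · subst hzw
      rw [Function.update_self] at hz
      exact Or.inr ⟨rfl, hz⟩
    by_cases hzv : z = v
    · subst hzv
      rw [Function.update_of_ne hzw, Function.update_self, Status.colour.injEq] at hz
      exact Or.inl ⟨rfl, hz.symm⟩
    · rw [Function.update_of_ne hzw, Function.update_of_ne hzv] at hz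
      exact absurd hz (hF.unused e he z)
  have hQU : ∀ z, z ∈ (U.erase v).erase w ↔ Q.status z = Status.unplayed := by
    intro z
    rw [hQ]
    by_cases hzw : z = w
    · subst hzw; simpa using hm
    by_cases hzv : z = v
    · subst hzv; simp [hzw]
    · simp [hzw, hzv, hF.mem_iff]
  have hcan : Q.CanColour G x d := by
    refine ⟨(hQU x).1 hx, fun z hz hzd => ?_⟩
    rcases hQcol d hd z hzd with ⟨rfl, h⟩ | ⟨rfl, h⟩
    · exact hxv h hz
    · exact hxw h hz
  refine MakerWinsFrom.maker Q _ (fun hE => hE.1 x d hcan) (Move.colour _ x d hcan) ?_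
  have hRcol : ∀ e ∈ F, ∀ z, (Q.play x (Status.colour d)).status z = Status.colour e →
      (z = v ∧ e = c) ∨ (z = w ∧ m = Status.colour e) ∨ (z = x ∧ e = d) := by
    intro e he z hz
    change Function.update Q.status x _ z = _ at hz
    by_cases hzx : z = x
    · subst hzx
      rw [Function.update_self, Status.colour.injEq] at hz
      exact Or.inr (Or.inr ⟨rfl, hz.symm⟩)
    · rw [Function.update_of_ne hzx] at hz
      have := hQcol e he z hz
      tauto
  have hRv : (Q.play x (Status.colour d)).status v = Status.colour c := by
    change Function.update Q.status x _ v = _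
    rw [Function.update_of_ne hxv'.symm, hQ, Function.update_of_ne hwv.symm, Function.update_self]
  have hRx : (Q.play x (Status.colour d)).status x = Status.colour d := by
    change Function.update Q.status x _ x = _
    rw [Function.update_self]
  refine makerWinsFrom_of_safe (U := ((U.erase v).erase w).erase x) (F := F) ?_ ?_
  · intro z
    change _ ↔ Function.update Q.status x _ z = _
    by_cases hzx : z = x
    · subst hzx; simp
    · rw [Function.update_of_ne hzx, ← hQU, mem_erase]
      simp [hzx]
  · intro u hu
    rcases hs u hu with ⟨A, B, hAB, hA, hBv, hBw, hBx⟩ | ⟨e, he, hev, hew, hex, hy⟩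
    · left
      refine lt_of_le_of_lt (Nat.add_le_add (card_le_card ?_) (card_le_card ?_)) hAB
      · intro y hy
        obtain ⟨hyU, hy⟩ := mem_filter.1 hy
        exact hA y hyU hy
      · intro e he
        obtain ⟨heF, z, hz, hze⟩ := mem_filter.1 he
        rcases hRcol e heF z hze with ⟨rfl, rfl⟩ | ⟨rfl, h⟩ | ⟨rfl, rfl⟩
        · exact hBv hz
        · exact hBw hz e heF h
        · exact hBx hz
    · right
      refine ⟨e, fun z hz hze => ?_, fun y hyU huy => ?_⟩
      · rcases hRcol e he z hze with ⟨rfl, h⟩ | ⟨rfl, h⟩ | ⟨rfl, h⟩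
        · exact hev h hz
        · exact hew h hz
        · exact hex h hz
      · rcases hy y hyU huy with ⟨rfl, h⟩ | ⟨rfl, h⟩
        · exact ⟨v, h, hRv⟩
        · exact ⟨x, h, hRx⟩

open Classical in
theorem wins_of_degree_lt (h : ∀ u ∈ U, #(U.filter (G.Adj u)) < k) :
    Wins G D K player U f M k := by
  rintro P ⟨-, F, hF, hkF, -⟩
  refine makerWinsFrom_of_safe (F := F) hF.mem_iff fun u hu => Or.inl ?_
  have : F.filter (fun c => ∃ w, G.Adj u w ∧ P.status w = Status.colour c) = ∅ := by
    rw [filter_eq_empty_iff]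
    rintro c hc ⟨w, -, hw⟩
    exact hF.unused c hc w hw
  rw [this, card_empty]
  have := h u hu
  omega

/-- Once `v` has the colour `c`, no vertex of the other class can get `c`, so the class of `v` is
safe for good. Maker's second move gives `c` to another vertex of this class. For a vertex of the
other class, the unplayed neighbours and the spoiled colours together then number at most the size
of the class of `v` minus one. -/
theorem wins_of_full {v : V} (hv : v ∈ U) (h3 : 3 ≤ #(labelClass U f (f v)))
    (hk : #(labelClass U f (f v)) ≤ k) (hfull : ∀ u ∈ U, f u ≠ f v → G.Adj v u)
    (htwo : ∀ u ∈ U, ∀ w ∈ U, f u ≠ f v → f w ≠ f v → f u = f w) :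
    Wins G D K Player.maker U f M k := by
  rintro P ⟨hp, F, hF, hkF, -⟩
  obtain ⟨c, hc⟩ : F.Nonempty := card_pos.1 (by omega)
  have hcU : #(labelClass U f (f v)) ≤ #U := card_le_card (filter_subset _ _)
  refine makerWinsFrom_of_replies' hF hv hc (by omega) (by omega) fun w hw m hm hmc Q hQ => ?_
  have hwU := mem_of_mem_erase hw
  have hvcl : v ∈ labelClass U f (f v) := mem_labelClass.2 ⟨hv, rfl⟩
  have hcv := card_erase_add_one hvcl
  have hcw := pred_card_le_card_erase (s := (labelClass U f (f v)).erase v) (a := w)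
  obtain ⟨x, hx⟩ : (((labelClass U f (f v)).erase v).erase w).Nonempty := card_pos.1 (by omega)
  have hcx := card_erase_add_one hx
  have hxU : x ∈ U := (mem_labelClass.1 (erase_erase_subset _ _ _ hx)).1
  have hxf : f x = f v := (mem_labelClass.1 (erase_erase_subset _ _ _ hx)).2
  have hwc : ∀ z ∈ U, f z = f v → m = Status.colour c → ¬ G.Adj z w := by
    intro z hz hzv hmc' hadj
    refine hmc hmc' (hfull w hwU fun hwv => ?_)
    exact hp z hz w hwU (hzv.trans hwv.symm) hadj
  have hsub : ((U.erase v).erase w).erase x ⊆ U :=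
    (erase_subset _ _).trans (erase_erase_subset _ _ _)
  refine makerWinsFrom_of_safe_move (x := x) (d := c) hF hw ?_ hm hQ hc
    (fun _ => hp x hxU v hv hxf) (hwc x hxU hxf) ?_
  · simp only [mem_erase] at hx ⊢
    exact ⟨hx.1, hx.2.1, hxU⟩
  intro u hu
  have huU := hsub hu
  by_cases hfu : f u = f v
  · right
    refine ⟨c, hc, fun _ => hp u huU v hv hfu, hwc u huU hfu,
      fun _ => hp u huU x hxU (hfu.trans hxf.symm), fun y hy huy => Or.inl ⟨rfl, ?_⟩⟩
    refine (hfull y (hsub hy) fun hyv => ?_).symm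
    exact hp u huU y (hsub hy) (hfu.trans hyv.symm) huy
  left
  have hA : ∀ y ∈ ((U.erase v).erase w).erase x, G.Adj u y →
      y ∈ (((labelClass U f (f v)).erase v).erase w).erase x := by
    intro y hy huy
    have hyv : f y = f v := by
      by_contra hyv
      exact hp u huU y (hsub hy) (htwo u huU y (hsub hy) hfu hyv) huy
    simp only [mem_erase, mem_labelClass] at hy ⊢
    tauto
  by_cases hwv : f w = f v
  · have hcw' := card_erase_add_one (s := (labelClass U f (f v)).erase v) (a := w)
      (mem_erase.2 ⟨ne_of_mem_erase hw, mem_labelClass.2 ⟨hwU, hwv⟩⟩)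
    obtain ⟨B, hB, hcB, hmB⟩ : ∃ B : Finset (Fin K), #B ≤ 2 ∧ c ∈ B ∧
        ∀ e, m = Status.colour e → e ∈ B := by
      cases m with
      | colour d =>
        exact ⟨{c, d}, card_le_two, by simp, fun e he => by
          rw [Status.colour.injEq] at he; simp [he]⟩
      | _ => exact ⟨{c}, by simp, by simp, by simp⟩
    exact ⟨_, B, by omega, hA, fun _ => hcB, fun _ e _ => hmB e, fun _ => hcB⟩
  · refine ⟨_, {c}, ?_, hA, by simp, fun h => ?_, by simp⟩
    · rw [card_singleton]
      have := card_erase_le (s := (labelClass U f (f v)).erase v) (a := w)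
      omega
    · exact absurd h (hp u huU w hwU (htwo u huU w hwU hfu hwv))

/-- If no vertex is adjacent to the whole opposite class, all degrees are below the class size,
hence below `k`, and every vertex is safe from the start. -/
theorem wins_of_equal_classes {i j : ℕ} (hp : ProperOn G U f)
    (h : ∀ u ∈ U, f u = i ∨ f u = j) (h3 : 3 ≤ #(labelClass U f i))
    (heq : #(labelClass U f i) = #(labelClass U f j)) (hk : #(labelClass U f i) ≤ k) :
    Wins G D K Player.maker U f M k := by
  classical
  have hcard : ∀ v ∈ U, #(labelClass U f (f v)) = #(labelClass U f i) := by
    intro v hv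
    rcases h v hv with h | h <;> rw [h, heq]
  have htwo : ∀ v ∈ U, ∀ u ∈ U, ∀ w ∈ U, f u ≠ f v → f w ≠ f v → f u = f w := by
    intro v hv u hu w hw huv hwv
    rcases h v hv with h1 | h1 <;> rcases h u hu with h2 | h2 <;> rcases h w hw with h4 | h4 <;>
      simp_all
  by_cases hfull : ∃ v ∈ U, ∀ u ∈ U, f u ≠ f v → G.Adj v u
  · obtain ⟨v, hv, hfull⟩ := hfull
    exact wins_of_full hv (by rw [hcard v hv]; exact h3) (by rw [hcard v hv]; exact hk) hfull
      (htwo v hv)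
  push Not at hfull
  refine wins_of_degree_lt fun u hu => lt_of_lt_of_le ?_ hk
  obtain ⟨w, hw, hwu, hnadj⟩ := hfull u hu
  rw [← hcard w hw]
  refine card_lt_card (Finset.ssubset_iff_subset_ne.2 ⟨fun y hy => ?_, fun he => ?_⟩)
  · obtain ⟨hyU, hy⟩ := mem_filter.1 hy
    refine mem_labelClass.2 ⟨hyU, ?_⟩
    exact htwo u hu y hyU w hw (fun e => hp u hu y hyU e.symm hy) hwu
  · have : w ∈ labelClass U f (f w) := mem_labelClass.2 ⟨hw, rfl⟩
    rw [← he, mem_filter] at this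
    exact hnadj this.2

end Bipartite

/-! ### The exceptional position with classes of sizes 3 and 4, and Maker's answers after one round.
-/

section Triple

open Finset

variable {V ι : Type*} {K : ℕ} {G : SimpleGraph V} {D : ι → Finset V}
variable [DecidableEq V] [DecidableEq ι]
variable {U : Finset V} {f : V → ℕ} {M : Finset ℕ} {k : ℕ} {player : Player}

/-- The complete bipartite graph with classes of sizes 3 and 4, minus a matching of size 3. -/
theorem wins_of_three_four_sub_matching {i j : ℕ} (hp : ProperOn G U f)
    (h : ∀ u ∈ U, f u = i ∨ f u = j) (hi : #(labelClass U f i) = 3)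
    (hj : #(labelClass U f j) = 4) (hk : 3 ≤ k) {g : V → V}
    (hgU : ∀ v ∈ U, f v = i → g v ∈ U) (hgj : ∀ v ∈ U, f v = i → f (g v) = j)
    (hg : ∀ v ∈ U, f v = i → ¬ G.Adj v (g v))
    (hadj : ∀ v ∈ U, f v = i → ∀ u ∈ U, f u = j → u ≠ g v → G.Adj v u)
    (hg' : ∀ v ∈ U, f v = i → ∀ x ∈ U, f x = i → x ≠ v → G.Adj x (g v)) :
    Wins G D K Player.maker U f M k := by
  rintro P ⟨-, F, hF, hkF, -⟩
  have hinj : ∀ v ∈ U, f v = i → ∀ x ∈ U, f x = i → x ≠ v → g x ≠ g v := by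
    intro v hv hvi x hx hxi hxv he
    exact hg x hx hxi (he ▸ hg' v hv hvi x hx hxi hxv)
  have hcimg : #((labelClass U f i).image g) = 3 := by
    rw [card_image_of_injOn, hi]
    intro v hv x hx hvx
    obtain ⟨hv, hvi⟩ := mem_labelClass.1 hv
    obtain ⟨hx, hxi⟩ := mem_labelClass.1 hx
    by_contra hne
    exact hinj x hx hxi v hv hvi hne hvx
  obtain ⟨v, hv, hvg⟩ : ∃ v ∈ labelClass U f j, v ∉ (labelClass U f i).image g := by
    by_contra! hall
    have := card_le_card (s := labelClass U f j) hall
    omega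
  obtain ⟨hvU, hvj⟩ := mem_labelClass.1 hv
  have hvfull : ∀ x ∈ U, f x = i → G.Adj x v := fun x hx hxi =>
    hadj x hx hxi v hvU hvj fun he =>
      hvg (mem_image.2 ⟨x, mem_labelClass.2 ⟨hx, hxi⟩, he.symm⟩)
  have hcj := card_erase_add_one hv
  have hcU : #(labelClass U f j) ≤ #U := card_le_card (filter_subset _ _)
  obtain ⟨c, hc⟩ : F.Nonempty := card_pos.1 (by omega)
  refine makerWinsFrom_of_replies' hF hvU hc (by omega) (by omega) fun w hw m hm hmc Q hQ => ?_
  have hwU := mem_of_mem_erase hw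
  have hwv := ne_of_mem_erase hw
  have hnbr : ∀ u ∈ U, f u = i → ∀ y ∈ U, G.Adj u y → f y = j := fun u hu hui y hy huy =>
    (h y hy).resolve_left fun hyi => hp u hu y hy (hui.trans hyi.symm) huy
  have hnbr' : ∀ u ∈ U, f u = j → ∀ y ∈ U, G.Adj u y → f y = i := fun u hu hui y hy huy =>
    (h y hy).resolve_right fun hyi => hp u hu y hy (hui.trans hyi.symm) huy
  have hsub : ∀ x, ((U.erase v).erase w).erase x ⊆ U := fun x =>
    (erase_subset _ _).trans (erase_erase_subset _ _ _)
  -- The unmatched vertex `v` has colour `c` and is adjacent to the whole class of size 3, so the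
  -- class of size 4 can always use `c`. If Breaker plays in the class of size 3, Maker gives `c` to
  -- the partner of his vertex. Each remaining vertex of that class then has one unplayed neighbour
  -- and one spoiled colour.
  rcases h w hwU with hwi | hwj
  · have hgw := hgU w hwU hwi
    have hgwj := hgj w hwU hwi
    have hmc' : m ≠ Status.colour c := fun he => hmc he (hvfull w hwU hwi).symm
    have hgv : g w ≠ v := fun he =>
      hvg (he ▸ mem_image_of_mem g (mem_labelClass.2 ⟨hwU, hwi⟩))
    have hgww : g w ≠ w := fun he =>
      hp w hwU v hvU (((congrArg f he).symm.trans hgwj).trans hvj.symm) (hvfull w hwU hwi)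
    refine makerWinsFrom_of_safe_move (x := g w) (d := c) hF hw
      (mem_erase.2 ⟨hgww, mem_erase.2 ⟨hgv, hgw⟩⟩) hm hQ hc
      (fun _ => hp _ hgw v hvU (hgwj.trans hvj.symm)) (fun he => absurd he hmc') fun u hu => ?_
    have huU := hsub _ hu
    have huw : u ≠ w := ne_of_mem_erase (mem_of_mem_erase hu)
    rcases h u huU with hui | huj
    · left
      have hc1 := card_erase_add_one (s := (labelClass U f j).erase v) (a := g w)
        (mem_erase.2 ⟨hgv, mem_labelClass.2 ⟨hgw, hgwj⟩⟩)
      have hguv : g u ≠ v := fun he =>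
        hvg (he ▸ mem_image_of_mem g (mem_labelClass.2 ⟨huU, hui⟩))
      have hc2 := card_erase_add_one (s := ((labelClass U f j).erase v).erase (g w)) (a := g u)
        (mem_erase.2 ⟨hinj w hwU hwi u huU hui huw,
          mem_erase.2 ⟨hguv, mem_labelClass.2 ⟨hgU u huU hui, hgj u huU hui⟩⟩⟩)
      refine ⟨(((labelClass U f j).erase v).erase (g w)).erase (g u), {c}, ?_, ?_, by simp,
        fun hadj' => absurd hadj' (hp u huU w hwU (hui.trans hwi.symm)), by simp⟩
      · rw [card_singleton]; omega
      · intro y hy huy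
        have hyj := hnbr u huU hui y (hsub _ hy) huy
        have hyg : y ≠ g u := by rintro rfl; exact hg u huU hui huy
        simp only [mem_erase, mem_labelClass] at hy ⊢
        tauto
    · right
      refine ⟨c, hc, fun _ => hp u huU v hvU (huj.trans hvj.symm), fun he => absurd he hmc',
        fun _ => hp u huU _ hgw (huj.trans hgwj.symm), fun y hy huy => Or.inl ⟨rfl, ?_⟩⟩
      exact hvfull y (hsub _ hy) (hnbr' u huU huj y (hsub _ hy) huy)
  have hcw := card_erase_add_one (s := (labelClass U f j).erase v) (a := w)
    (mem_erase.2 ⟨hwv, mem_labelClass.2 ⟨hwU, hwj⟩⟩)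
  -- If Breaker spoils a second colour in the class of size 4, Maker gives a third colour `d` to the
  -- partner `x` of `w`. All unplayed vertices of the class of size 4 are adjacent to `x`, so `d`
  -- stays available for the class of size 3.
  by_cases hfresh : ∃ e ∈ F, m = Status.colour e ∧ e ≠ c
  · obtain ⟨e, heF, rfl, hec⟩ := hfresh
    have himg : (labelClass U f i).image g = (labelClass U f j).erase v := by
      refine eq_of_subset_of_card_le (fun y hy => ?_) (by omega)
      obtain ⟨x, hx, rfl⟩ := mem_image.1 hy
      have hx' := mem_labelClass.1 hx
      exact mem_erase.2 ⟨fun he => hvg (he ▸ hy),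
        mem_labelClass.2 ⟨hgU x hx'.1 hx'.2, hgj x hx'.1 hx'.2⟩⟩
    obtain ⟨x, hx, hxw⟩ : ∃ x ∈ labelClass U f i, g x = w := by
      rw [← mem_image, himg]
      exact mem_erase.2 ⟨hwv, mem_labelClass.2 ⟨hwU, hwj⟩⟩
    obtain ⟨hxU, hxi⟩ := mem_labelClass.1 hx
    have hcF := card_erase_add_one hc
    have heF' := card_erase_add_one (s := F.erase c) (mem_erase.2 ⟨hec, heF⟩)
    obtain ⟨d, hd⟩ : ((F.erase c).erase e).Nonempty := card_pos.1 (by omega)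
    have hde : e ≠ d := (ne_of_mem_erase hd).symm
    have hdc : d ≠ c := ne_of_mem_erase (mem_of_mem_erase hd)
    have hdF : d ∈ F := mem_of_mem_erase (mem_of_mem_erase hd)
    have hed : (Status.colour e : Status K) ≠ Status.colour d := by simpa using hde
    have hec' : (Status.colour e : Status K) ≠ Status.colour c := by simpa using hec
    have hxv : x ≠ v := by rintro rfl; exact (hvfull x hxU hxi).ne rfl
    have hxw' : x ≠ w := by
      rintro rfl
      exact (hvfull x hxU hxi) |> hp x hxU v hvU (hwj.trans hvj.symm)
    refine makerWinsFrom_of_safe_move (x := x) (d := d) hF hw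
      (mem_erase.2 ⟨hxw', mem_erase.2 ⟨hxv, hxU⟩⟩) hm hQ hdF
      (fun he => absurd he hdc) (fun he => absurd he hed) fun u hu => Or.inr ?_
    have huU := hsub _ hu
    rcases h u huU with hui | huj
    · refine ⟨d, hdF, fun he => absurd he hdc, fun he => absurd he hed,
        fun _ => hp u huU x hxU (hui.trans hxi.symm), fun y hy huy => Or.inr ⟨rfl, ?_⟩⟩
      refine (hadj x hxU hxi y (hsub _ hy) (hnbr u huU hui y (hsub _ hy) huy) ?_).symm
      rw [hxw]
      exact ne_of_mem_erase (mem_of_mem_erase hy)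
    · refine ⟨c, hc, fun _ => hp u huU v hvU (huj.trans hvj.symm), fun he => absurd he hec',
        fun he => absurd he.symm hdc, fun y hy huy => Or.inl ⟨rfl, ?_⟩⟩
      exact hvfull y (hsub _ hy) (hnbr' u huU huj y (hsub _ hy) huy)
  -- Otherwise `c` is the only colour of `F` in use; Maker repeats it in the class of size 4, where
  -- one unplayed vertex remains.
  push Not at hfresh
  obtain ⟨x, hx⟩ : (((labelClass U f j).erase v).erase w).Nonempty := card_pos.1 (by omega)
  have hcx := card_erase_add_one hx
  obtain ⟨hxU, hxj⟩ := mem_labelClass.1 (erase_erase_subset _ _ _ hx)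
  refine makerWinsFrom_of_safe_move (x := x) (d := c) hF hw ?_ hm hQ hc
    (fun _ => hp x hxU v hvU (hxj.trans hvj.symm))
    (fun _ => hp x hxU w hwU (hxj.trans hwj.symm)) fun u hu => ?_
  · simp only [mem_erase] at hx ⊢
    exact ⟨hx.1, hx.2.1, hxU⟩
  have huU := hsub _ hu
  rcases h u huU with hui | huj
  · left
    refine ⟨(((labelClass U f j).erase v).erase w).erase x, {c}, ?_, fun y hy huy => ?_, by simp,
      fun _ e he hme => ?_, by simp⟩
    · rw [card_singleton]; omega
    · have hyj := hnbr u huU hui y (hsub _ hy) huy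
      simp only [mem_erase, mem_labelClass] at hy ⊢
      tauto
    · exact mem_singleton.2 (hfresh e he hme)
  · right
    refine ⟨c, hc, fun _ => hp u huU v hvU (huj.trans hvj.symm),
      fun _ => hp u huU w hwU (huj.trans hwj.symm),
      fun _ => hp u huU x hxU (huj.trans hxj.symm), fun y hy huy => Or.inl ⟨rfl, ?_⟩⟩
    exact hvfull y (hsub _ hy) (hnbr' u huU huj y (hsub _ hy) huy)

/-- Maker has an answer when she has given a new colour to `v` and Breaker has then given the same
colour to `w`. -/
def HasAnswer (G : SimpleGraph V) (D : ι → Finset V) (K : ℕ) (U : Finset V) (k : ℕ) (v w : V) :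
    Prop :=
  ∃ (f' : V → ℕ) (i : ℕ), ProperOn G ((U.erase v).erase w) f' ∧
    (∀ u ∈ (U.erase v).erase w, f' u = i → ¬ G.Adj u v) ∧
    (∀ u ∈ (U.erase v).erase w, f' u = i → ¬ G.Adj u w) ∧
    Wins G D K Player.maker ((U.erase v).erase w) f' {i} (k - 1)

/-- Maker has an answer when she has given a new colour to `v` and Breaker has then given another
new colour to `w`. -/
def HasAnswerNew (G : SimpleGraph V) (D : ι → Finset V) (K : ℕ) (U : Finset V) (k : ℕ) (v w : V) :
    Prop :=
  ∃ (f' : V → ℕ) (i j : ℕ), ProperOn G ((U.erase v).erase w) f' ∧ i ≠ j ∧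
    (∀ u ∈ (U.erase v).erase w, f' u = i → ¬ G.Adj u v) ∧
    (∀ u ∈ (U.erase v).erase w, f' u = j → ¬ G.Adj u w) ∧
    Wins G D K Player.maker ((U.erase v).erase w) f' {i, j} (k - 2)

theorem exists_unused_label (U : Finset V) (f : V → ℕ) : ∃ l, ∀ u ∈ U, f u ≠ l := by
  obtain ⟨l, hl⟩ := Infinite.exists_notMem_finset (U.image f)
  exact ⟨l, fun u hu he => hl (he ▸ mem_image_of_mem f hu)⟩

theorem hasAnswer_of_wins {v w : V} (hp : ProperOn G U f)
    (h : Wins G D K Player.maker ((U.erase v).erase w) f ∅ (k - 1)) : HasAnswer G D K U k v w := by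
  obtain ⟨l, hl⟩ := exists_unused_label U f
  have hsub := erase_erase_subset U v w
  exact ⟨f, l, hp.mono hsub, fun u hu he => absurd he (hl u (hsub hu)),
    fun u hu he => absurd he (hl u (hsub hu)), h.mono (by simp) le_rfl⟩

theorem ProperOn.update {x : V} {l : ℕ} (hp : ProperOn G U f) (hl : ∀ u ∈ U, f u ≠ l) :
    ProperOn G U (Function.update f x l) := by
  intro u hu y hy he
  by_cases hux : u = x
  · by_cases hyx : y = x
    · subst hux; subst hyx; exact G.irrefl
    · subst hux
      rw [Function.update_self, Function.update_of_ne hyx] at he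
      exact absurd he.symm (hl y hy)
  · by_cases hyx : y = x
    · subst hyx
      rw [Function.update_self, Function.update_of_ne hux] at he
      exact absurd he (hl u hu)
    · rw [Function.update_of_ne hux, Function.update_of_ne hyx] at he
      exact hp u hu y hy he

theorem card_image_update_le (U : Finset V) (f : V → ℕ) (x : V) (l : ℕ) :
    #(U.image (Function.update f x l)) ≤ #(U.image f) + 1 := by
  refine (card_le_card (t := insert l (U.image f)) ?_).trans (card_insert_le _ _)
  intro a ha
  obtain ⟨u, hu, rfl⟩ := mem_image.1 ha
  by_cases hux : u = x
  · subst hux; simp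
  · rw [Function.update_of_ne hux]
    exact mem_insert_of_mem (mem_image_of_mem f hu)

theorem eq_of_update_eq {x u : V} {l : ℕ} (hl : ∀ u ∈ U, f u ≠ l) (hu : u ∈ U)
    (h : Function.update f x l u = l) : u = x := by
  by_contra hux
  rw [Function.update_of_ne hux] at h
  exact hl u hu h

/-- The vertex `x` is made a class of its own, served by the colour of `v` even if Breaker repeated
it at `w`. The extra class costs one, and a marked singleton is worth more than that. -/
theorem hasAnswer_of_common {v w x : V} (hp : ProperOn G U f) (hv : v ∈ U) (hw : w ∈ U.erase v)
    (hx : x ∈ (U.erase v).erase w) (hxv : ¬ G.Adj x v) (hxw : ¬ G.Adj x w) (hn : 6 ≤ #U)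
    (hk : #(U.image f) + #U / 2 ≤ k + 2) : HasAnswer G D K U k v w := by
  obtain ⟨l, hl⟩ := exists_unused_label U f
  have hsub := erase_erase_subset U v w
  have hl' : ∀ u ∈ (U.erase v).erase w, f u ≠ l := fun u hu => hl u (hsub hu)
  have hc := card_erase_erase hv hw
  have hq1 := card_image_update_le ((U.erase v).erase w) f x l
  have hq2 := card_le_card (image_subset_image (f := f) hsub)
  refine ⟨Function.update f x l, l, (hp.mono hsub).update hl', ?_, ?_, ?_⟩
  · intro u hu he
    rwa [eq_of_update_eq hl' hu he]
  · intro u hu he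
    rwa [eq_of_update_eq hl' hu he]
  · refine wins_of_alone_marked hx (by simp) (fun u hu he => ?_) (by omega) (by omega)
    rw [Function.update_self] at he
    exact eq_of_update_eq hl' hu he

end Triple

/-! ### Replies with a new colour in another class, and a marked class among large ones. -/

section Large

open Finset

variable {V ι : Type*} {K : ℕ} {G : SimpleGraph V} {D : ι → Finset V}
variable [DecidableEq V] [DecidableEq ι]
variable {U : Finset V} {f : V → ℕ} {M : Finset ℕ} {k : ℕ} {player : Player}

theorem labels_of_card_image_le_two {v w : V} (h : #(U.image f) ≤ 2) (hv : v ∈ U) (hw : w ∈ U)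
    (hvw : f v ≠ f w) : ∀ u ∈ U, f u = f v ∨ f u = f w := by
  have h2 : ({f v, f w} : Finset ℕ) = U.image f := by
    refine eq_of_subset_of_card_le (fun l hl => ?_) (by rw [card_pair hvw]; exact h)
    simp only [mem_insert, mem_singleton] at hl
    rcases hl with rfl | rfl
    · exact mem_image_of_mem f hv
    · exact mem_image_of_mem f hw
  intro u hu
  have := mem_image_of_mem f hu
  rw [← h2] at this
  simpa using this

theorem two_le_card_image {v w : V} (hv : v ∈ U) (hw : w ∈ U) (hvw : f v ≠ f w) :
    2 ≤ #(U.image f) := by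
  by_contra h
  exact hvw (label_eq_of_card_image_le_one (by omega) hv hw)

theorem exists_mem_label_of_two_le {v w : V} (hv : v ∈ U) (hw : f w ≠ f v)
    (h : 2 ≤ #(labelClass U f (f v))) : ∃ x ∈ (U.erase v).erase w, f x = f v := by
  have := card_labelClass_erase_self (f := f) hv
  obtain ⟨x, hx⟩ := card_pos.1 (show 0 < #(labelClass (U.erase v) f (f v)) by omega)
  obtain ⟨hx, hxv⟩ := mem_labelClass.1 hx
  exact ⟨x, mem_erase.2 ⟨by rintro rfl; exact hw hxv, hx⟩, hxv⟩

theorem exists_mem_label_of_three_le {v : V} (w : V) (hv : v ∈ U)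
    (h : 3 ≤ #(labelClass U f (f v))) : ∃ x ∈ (U.erase v).erase w, f x = f v := by
  have h1 := card_erase_add_one (mem_labelClass.2 ⟨hv, rfl⟩ : v ∈ labelClass U f (f v))
  have h2 := pred_card_le_card_erase (s := (labelClass U f (f v)).erase v) (a := w)
  obtain ⟨x, hx⟩ := card_pos.1 (show 0 < #(((labelClass U f (f v)).erase v).erase w) by omega)
  simp only [mem_erase, mem_labelClass] at hx
  exact ⟨x, by simp only [mem_erase]; tauto, hx.2.2.2⟩

theorem alone_of_card_labelClass {v : V} (hv : v ∈ U) (h : #(labelClass U f (f v)) ≤ 1) :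
    ∀ u ∈ U, f u = f v → u = v := fun u hu huv =>
  card_le_one.1 h u (mem_labelClass.2 ⟨hu, huv⟩) v (mem_labelClass.2 ⟨hv, rfl⟩)

/-- Both classes touched have lost one vertex and are marked. If neither has vanished, two marks
suffice, but with only two classes their sizes must differ. If the class of `w` has vanished, the
drop of q makes one mark enough. -/
theorem wins_of_reply_elsewhere {v w x : V} (hv : v ∈ U) (hw : w ∈ U.erase v) (hvw : f w ≠ f v)
    (hx : x ∈ (U.erase v).erase w) (hxv : f x = f v) (hn : 6 ≤ #U)
    (hk : #(U.image f) + #U / 2 ≤ k + 4)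
    (hq : 3 ≤ #(U.image f) ∨ #(labelClass U f (f v)) ≠ #(labelClass U f (f w))) :
    Wins G D K Player.maker ((U.erase v).erase w) f {f v, f w} k := by
  have hwU := mem_of_mem_erase hw
  have hc := card_erase_erase hv hw
  have hsub := erase_erase_subset U v w
  have hq2 := two_le_card_image hv hwU hvw.symm
  have hq' := card_le_card (image_subset_image (f := f) hsub)
  by_cases hqq : #(U.image f) ≤ #(((U.erase v).erase w).image f)
  · obtain ⟨y, hy, hyw⟩ := exists_label_mem_of_card_image_eq hsub hwU hqq
    by_cases hq3 : 3 ≤ #(U.image f)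
    · exact wins_of_two_marked hx hy (by rw [hxv, hyw]; exact hvw.symm) (by simp [hxv])
        (by simp [hyw]) (by omega) (by omega) (by omega)
    · have hne := hq.resolve_left hq3
      have hlab := labels_of_card_image_le_two (by omega) hv hwU hvw.symm
      have h1 := card_labelClass_erase_self (f := f) hv
      have h2 := labelClass_erase_of_ne (U := U) hvw.symm
      have h3 := card_labelClass_erase_self (f := f) hw
      have h4 := labelClass_erase_of_ne (U := U.erase v) hvw
      have h5 : 1 ≤ #(labelClass ((U.erase v).erase w) f (f w)) :=
        card_pos.2 ⟨y, mem_labelClass.2 ⟨hy, hyw⟩⟩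
      have h6 : 1 ≤ #(labelClass ((U.erase v).erase w) f (f v)) :=
        card_pos.2 ⟨x, mem_labelClass.2 ⟨hx, hxv⟩⟩
      rw [h2] at h3
      rw [← h4] at h1
      rcases lt_or_gt_of_ne (show #(labelClass ((U.erase v).erase w) f (f v)) ≠
          #(labelClass ((U.erase v).erase w) f (f w)) by omega) with hlt | hlt
      · exact wins_of_two_labels hvw.symm (by simp) (by simp) (fun u hu => hlab u (hsub hu)) h6
          hlt (by omega)
      · exact wins_of_two_labels hvw (by simp) (by simp) (fun u hu => (hlab u (hsub hu)).symm) h5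
          hlt (by omega)
  · exact wins_strong (by omega) (by omega) ⟨x, hx, by simp [hxv]⟩

/-- A reply with a new colour in a marked class can be survived if all other classes are large,
provided that smaller positions with a large class are won. -/
theorem wins_of_marked_among_large {x y : V} (hp : ProperOn G U f) (hx : x ∈ U) (hxM : f x ∈ M)
    (hy : y ∈ U) (hyx : f y ≠ f x) (hlarge : ∀ u ∈ U, f u ≠ f x → 4 ≤ #(labelClass U f (f u)))
    (hq : 3 ≤ #(U.image f) ∨
      ∀ u ∈ U, f u ≠ f x → #(labelClass U f (f x)) + 2 ≤ #(labelClass U f (f u)))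
    (hk : #(U.image f) + #U / 2 ≤ k + 3)
    (ih : ∀ (U' : Finset V) (M' : Finset ℕ) (k' : ℕ), #U' < #U → 6 ≤ #U' →
      #(U'.image f) + #U' / 2 ≤ k' + 2 → ProperOn G U' f →
      (∃ u ∈ U', 3 ≤ #(labelClass U' f (f u))) → Wins G D K Player.maker U' f M' k') :
    Wins G D K Player.maker U f M k := by
  induction hm : #U using Nat.strong_induction_on generalizing U M k x with
  | _ n ihn =>
  subst hm
  have hy4 := hlarge y hy hyx
  have hxpos : 1 ≤ #(labelClass U f (f x)) := card_pos.2 ⟨x, mem_labelClass.2 ⟨hx, rfl⟩⟩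
  have hsum := card_labelClass_add_le (U := U) (f := f) hyx
  have hq2 := two_le_card_image hy hx hyx
  by_cases hone : #(labelClass U f (f x)) ≤ 1
  · exact wins_of_alone_marked hx hxM (alone_of_card_labelClass hx hone) (by omega) hk
  have hclx := card_labelClass_erase_self (f := f) hx
  obtain ⟨x₁, hx₁⟩ := card_pos.1 (show 0 < #(labelClass (U.erase x) f (f x)) by omega)
  obtain ⟨hx₁U, hx₁x⟩ := mem_labelClass.1 hx₁
  refine Wins.maker_blank hx hxM ?_
  refine Wins.breaker (Or.inr (Or.inr ⟨x₁, hx₁U, hx₁x ▸ hxM⟩)) ?_ ?_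
  · intro w hw hk1
    have hwU := mem_of_mem_erase hw
    have hsub := erase_erase_subset U x w
    have hc := card_erase_erase hx hw
    have hq' := card_le_card (image_subset_image (f := f) hsub)
    by_cases hwx : f w = f x
    · have hclw := card_labelClass_erase_self (f := f) hw
      rw [hwx] at hclw
      have hother : ∀ i, i ≠ f x →
          labelClass ((U.erase x).erase w) f i = labelClass U f i := fun i hi => by
        rw [labelClass_erase_of_ne (by rw [hwx]; exact hi.symm), labelClass_erase_of_ne hi.symm]
      have hyU : y ∈ (U.erase x).erase w := mem_erase.2
        ⟨by rintro rfl; exact hyx hwx, mem_erase.2 ⟨by rintro rfl; exact hyx rfl, hy⟩⟩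
      -- When the marked class is exhausted, q drops, which brings the position within the bound k +
      -- 2 that `ih` needs without a mark.
      by_cases htwo : #(labelClass U f (f x)) = 2
      · have hnone : ∀ u ∈ (U.erase x).erase w, f u ≠ f x := by
          intro u hu hux
          have : 0 < #(labelClass ((U.erase x).erase w) f (f x)) :=
            card_pos.2 ⟨u, mem_labelClass.2 ⟨hu, hux⟩⟩
          omega
        have hqlt := card_image_lt_of_label_missing hsub hx hnone
        by_cases hq1 : #(((U.erase x).erase w).image f) ≤ 1
        · exact wins_of_single (i := f y) (by omega)
            fun u hu => label_eq_of_card_image_le_one hq1 hu hyU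
        · obtain ⟨z, hz, hzy⟩ : ∃ z ∈ (U.erase x).erase w, f z ≠ f y := by
            by_contra! hall
            have := card_image_le_two (U := (U.erase x).erase w) (f := f) (i := f y) (j := f y)
              (fun u hu => Or.inl (hall u hu))
            refine hq1 (card_le_one.2 fun a ha b hb => ?_)
            obtain ⟨a', ha', rfl⟩ := mem_image.1 ha
            obtain ⟨b', hb', rfl⟩ := mem_image.1 hb
            rw [hall a' ha', hall b' hb']
          have hz4 := hlarge z (hsub hz) (hnone z hz)
          have hsum' := card_labelClass_add_le (U := (U.erase x).erase w) (f := f) hzy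
          rw [hother _ (hnone z hz), hother _ hyx] at hsum'
          exact ih _ _ _ (by omega) (by omega) (by omega) (hp.mono hsub)
            ⟨y, hyU, by rw [hother _ hyx]; omega⟩
      · obtain ⟨x₂, hx₂⟩ := card_pos.1
          (show 0 < #(labelClass ((U.erase x).erase w) f (f x)) by omega)
        obtain ⟨hx₂U, hx₂x⟩ := mem_labelClass.1 hx₂
        refine ihn _ (by omega) (hp.mono hsub) hx₂U (mem_insert_of_mem (hx₂x ▸ hxM)) hyU
          (by rw [hx₂x]; exact hyx) ?_ ?_ (by omega)
          (fun U' M' k' hU' => ih U' M' k' (by omega)) rfl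
        · intro u hu hux
          rw [hx₂x] at hux
          rw [hother _ hux]
          exact hlarge u (hsub hu) hux
        · refine hq.imp (fun hq3 => ?_) (fun hq3 u hu hux => ?_)
          · refine hq3.trans (card_le_card ?_)
            intro i hi
            obtain ⟨u, hu, rfl⟩ := mem_image.1 hi
            by_cases hux : f u = f x
            · rw [hux, ← hx₂x]
              exact mem_image_of_mem f hx₂U
            · refine mem_image_of_mem f (mem_erase.2 ⟨?_, mem_erase.2 ⟨?_, hu⟩⟩)
              · rintro rfl; exact hux hwx
              · rintro rfl; exact hux rfl
          · rw [hx₂x] at hux ⊢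
            rw [hother _ hux]
            have := hq3 u (hsub hu) hux
            omega
    · obtain ⟨x₂, hx₂U, hx₂x⟩ := exists_mem_label_of_two_le hx hwx (by omega)
      refine (wins_of_reply_elsewhere (k := k - 1) hx hw hwx hx₂U hx₂x (by omega) (by omega)
        (hq.imp_right fun h => ?_)).mono ?_ le_rfl
      · have := h w hwU hwx
        omega
      · intro i hi
        simp only [mem_insert, mem_singleton] at hi
        rcases hi with rfl | rfl
        · exact mem_insert_of_mem hxM
        · exact mem_insert_self _ _
  · intro w hw l hl
    have hwU := mem_of_mem_erase hw
    have hsub := erase_erase_subset U x w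
    have hc := card_erase_erase hx hw
    have hq' := card_le_card (image_subset_image (f := f) hsub)
    -- If Breaker spends no colour, he can spoil the mark only by playing outside the marked class.
    by_cases hwx : f w = f x
    · exact wins_of_subset_of_marked hsub hc (by omega) hx
        (mem_erase.2 ⟨by rw [← hwx]; exact hl.symm, hxM⟩) hk
    obtain ⟨x₂, hx₂U, hx₂x⟩ := exists_mem_label_of_two_le hx hwx (by omega)
    have hclx' := labelClass_erase_of_ne (U := U.erase x) hwx
    by_cases htwo : #(labelClass U f (f x)) = 2
    · refine wins_of_alone hx₂U (alone_of_card_labelClass hx₂U ?_) (by omega) (by omega)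
      rw [hx₂x, hclx']
      omega
    have hw4 := hlarge w hwU hwx
    have hclw := card_labelClass_erase_self (f := f) hw
    rw [labelClass_erase_of_ne (fun e => hwx e.symm)] at hclw
    obtain ⟨w', hw'⟩ := card_pos.1
      (show 0 < #(labelClass ((U.erase x).erase w) f (f w)) by omega)
    obtain ⟨hw'U, hw'w⟩ := mem_labelClass.1 hw'
    -- Eight vertices are needed because `ih` asks for six after the round.
    have h8 : 8 ≤ #U := by
      by_cases hq3 : 3 ≤ #(U.image f)
      · obtain ⟨z, hz, hzx, hzw⟩ := exists_label_ne_ne hq3 (f x) (f w)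
        have := card_labelClass_add_le (U := U) (f := f) hzw
        have := hlarge z hz hzx
        omega
      · have := hq.resolve_left hq3 y hy hyx
        omega
    exact ih _ _ _ (by omega) (by omega) (by omega) (hp.mono hsub)
      ⟨w', hw'U, by rw [hw'w]; omega⟩

end Large

/-! ### Positions without marked classes. -/

section Unmarked

open Finset

variable {V ι : Type*} {K : ℕ} {G : SimpleGraph V} {D : ι → Finset V}
variable [DecidableEq V] [DecidableEq ι]
variable {U : Finset V} {f : V → ℕ} {M : Finset ℕ} {k : ℕ} {player : Player}

theorem hasAnswerNew_of_wins {v w : V} (hp : ProperOn G U f) (hv : v ∈ U)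
    (h : Wins G D K Player.maker ((U.erase v).erase w) f {f v} (k - 2)) :
    HasAnswerNew G D K U k v w := by
  obtain ⟨l, hl⟩ := exists_unused_label U f
  have hsub := erase_erase_subset U v w
  exact ⟨f, f v, l, hp.mono hsub, hl v hv, fun u hu he => hp u (hsub hu) v hv he,
    fun u hu he => absurd he (hl u (hsub hu)), h.mono (by simp) le_rfl⟩

theorem hasAnswerNew_of_wins_pair {v w : V} (hp : ProperOn G U f) (hv : v ∈ U)
    (hw : w ∈ U.erase v) (hvw : f w ≠ f v)
    (h : Wins G D K Player.maker ((U.erase v).erase w) f {f v, f w} (k - 2)) :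
    HasAnswerNew G D K U k v w := by
  have hsub := erase_erase_subset U v w
  exact ⟨f, f v, f w, hp.mono hsub, hvw.symm, fun u hu he => hp u (hsub hu) v hv he,
    fun u hu he => hp u (hsub hu) w (mem_of_mem_erase hw) he, h⟩

/-- In a game without marked classes Maker starts in a class with 2 vertices. -/
theorem wins_of_class_two {v : V} (hp : ProperOn G U f) (hv : v ∈ U)
    (hcl : #(labelClass U f (f v)) = 2) (hn : 6 ≤ #U) (hk : #(U.image f) + #U / 2 ≤ k + 2)
    (hsame : ∀ w ∈ U.erase v, f w = f v → HasAnswerNew G D K U k v w) :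
    Wins G D K Player.maker U f M k := by
  have hq := card_image_pos (f := f) hv
  have hclv := card_labelClass_erase_self (f := f) hv
  refine Wins.round hv (by omega) (by omega) (fun w hw => ?_) (fun w hw => ?_)
  · by_cases hwv : f w = f v
    · exact hsame w hw hwv
    have hc := card_erase_erase hv hw
    have hsub := erase_erase_subset U v w
    have hq' := card_le_card (image_subset_image (f := f) hsub)
    obtain ⟨x, hx, hxv⟩ := exists_mem_label_of_two_le hv hwv (by omega)
    refine hasAnswerNew_of_wins hp hv (wins_of_alone_marked hx (by simp [hxv])
      (alone_of_card_labelClass hx ?_) (by omega) (by omega))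
    rw [hxv, labelClass_erase_of_ne hwv]
    omega
  · have hc := card_erase_erase hv hw
    have hsub := erase_erase_subset U v w
    have hq' := card_le_card (image_subset_image (f := f) hsub)
    suffices hA : HasAnswer G D K U k v w by
      obtain ⟨f', i, h1, h2, h3, h4⟩ := hA
      exact ⟨f', i, h1, h2, fun _ => h3, h4⟩
    refine hasAnswer_of_wins hp ?_
    by_cases hwv : f w = f v
    · have hclw := card_labelClass_erase_self (f := f) hw
      rw [hwv] at hclw
      have := card_image_lt_of_label_missing hsub hv fun u hu huv => by
        have : 0 < #(labelClass ((U.erase v).erase w) f (f v)) :=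
          card_pos.2 ⟨u, mem_labelClass.2 ⟨hu, huv⟩⟩
        omega
      exact wins_weak (by omega) (by omega)
    · obtain ⟨x, hx, hxv⟩ := exists_mem_label_of_two_le hv hwv (by omega)
      refine wins_of_alone hx (alone_of_card_labelClass hx ?_) (by omega) (by omega)
      rw [hxv, labelClass_erase_of_ne hwv]
      omega

/-- In a game without marked classes Maker starts in a class with at least 3 vertices. -/
theorem wins_of_class_three_le {v : V} (hp : ProperOn G U f) (hv : v ∈ U)
    (hcl : 3 ≤ #(labelClass U f (f v))) (hn : 6 ≤ #U) (hk : #(U.image f) + #U / 2 ≤ k + 2)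
    (hq : 3 ≤ #(U.image f) ∨ ∀ u ∈ U, f u ≠ f v → #(labelClass U f (f v)) ≠ #(labelClass U f (f u)))
    (hsame : ∀ w ∈ U.erase v, f w = f v → HasAnswerNew G D K U k v w)
    (hother : ∀ w ∈ U.erase v, f w ≠ f v → ¬ G.Adj v w → HasAnswer G D K U k v w) :
    Wins G D K Player.maker U f M k := by
  have hq1 := card_image_pos (f := f) hv
  refine Wins.round hv (by omega) (by omega) (fun w hw => ?_) (fun w hw => ?_)
  · by_cases hwv : f w = f v
    · exact hsame w hw hwv
    obtain ⟨x, hx, hxv⟩ := exists_mem_label_of_two_le hv hwv (by omega)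
    exact hasAnswerNew_of_wins_pair hp hv hw hwv (wins_of_reply_elsewhere hv hw hwv hx hxv hn
      (by omega) (hq.imp_right fun h => h w (mem_of_mem_erase hw) hwv))
  · have hc := card_erase_erase hv hw
    have hsub := erase_erase_subset U v w
    have hq' := card_le_card (image_subset_image (f := f) hsub)
    -- Repeating the colour of `v` at `w` harms the class of `v` only if `w` lies outside this class
    -- and is not adjacent to `v`; otherwise the class stays marked.
    by_cases hbad : f w ≠ f v ∧ ¬ G.Adj v w
    · obtain ⟨f', i, h1, h2, h3, h4⟩ := hother w hw hbad.1 hbad.2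
      exact ⟨f', i, h1, h2, fun _ => h3, h4⟩
    obtain ⟨x, hx, hxv⟩ := exists_mem_label_of_three_le w hv hcl
    refine ⟨f, f v, hp.mono hsub, fun u hu he => hp u (hsub hu) v hv he, fun hadj u hu he => ?_,
      wins_strong (by omega) (by omega) ⟨x, hx, by simp [hxv]⟩⟩
    have hwv : f w = f v := by
      by_contra hne
      exact hbad ⟨hne, hadj⟩
    exact hp u (hsub hu) w (mem_of_mem_erase hw) (he.trans hwv.symm)

/-- In a game without marked classes Maker starts in a class with 3 vertices. -/
theorem wins_of_class_three {v : V} (hp : ProperOn G U f) (hv : v ∈ U)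
    (hcl : #(labelClass U f (f v)) = 3) (hn : 6 ≤ #U) (hk : #(U.image f) + #U / 2 ≤ k + 2)
    (hq : 3 ≤ #(U.image f) ∨ ∀ u ∈ U, f u ≠ f v → #(labelClass U f (f u)) ≠ 3)
    (hother : ∀ w ∈ U.erase v, f w ≠ f v → ¬ G.Adj v w → HasAnswer G D K U k v w) :
    Wins G D K Player.maker U f M k := by
  refine wins_of_class_three_le hp hv hcl.ge hn hk
    (hq.imp_right fun h u hu huv => by rw [hcl]; exact (h u hu huv).symm) (fun w hw hwv => ?_) hother
  have hc := card_erase_erase hv hw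
  have hsub := erase_erase_subset U v w
  have hq' := card_le_card (image_subset_image (f := f) hsub)
  obtain ⟨x, hx, hxv⟩ := exists_mem_label_of_three_le w hv hcl.ge
  refine hasAnswerNew_of_wins hp hv (wins_of_alone_marked hx (by simp [hxv])
    (alone_of_card_labelClass hx ?_) (by omega) (by omega))
  have h1 := card_labelClass_erase_self (f := f) hv
  have h2 := card_labelClass_erase_self (f := f) hw
  rw [hwv] at h2
  rw [hxv]
  omega

/-- If opening at a vertex `x` of the smaller class fails, some nonadjacent `g x` in the other class
has no common nonneighbour with `x`. Then `x` is adjacent to the rest of the larger class, and `g x`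
to the rest of the smaller one. If every opening fails, the graph is complete bipartite minus a
matching. -/
theorem wins_of_three_four {v w : V} (hp : ProperOn G U f) (hv : v ∈ U) (hw : w ∈ U)
    (hvw : f v ≠ f w) (hq : #(U.image f) ≤ 2) (hcv : #(labelClass U f (f v)) = 3)
    (hcw : #(labelClass U f (f w)) = 4) (hk : 3 ≤ k) : Wins G D K Player.maker U f M k := by
  have hlab := labels_of_card_image_le_two hq hv hw hvw
  have hcard := card_eq_of_two_labels hvw hlab
  by_contra hW
  have key : ∀ x ∈ U, f x = f v → ∃ y ∈ U.erase x, f y ≠ f v ∧ ¬ G.Adj x y ∧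
      ∀ z ∈ (U.erase x).erase y, ¬ G.Adj z x → G.Adj z y := by
    intro x hx hxv
    by_contra! hall
    refine hW (wins_of_class_three hp hx (by rw [hxv, hcv]) (by omega) (by omega) (Or.inr ?_) ?_)
    · intro u hu hux
      rw [hxv] at hux
      rw [(hlab u hu).resolve_left hux, hcw]
      omega
    · intro y hy hyx hadj
      obtain ⟨z, hz, hzx, hzy⟩ := hall y hy (hxv ▸ hyx) hadj
      exact hasAnswer_of_common hp hx hy hz hzx hzy (by omega) (by omega)
  have key' : ∀ x, ∃ y, x ∈ U → f x = f v → y ∈ U.erase x ∧ f y ≠ f v ∧ ¬ G.Adj x y ∧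
      ∀ z ∈ (U.erase x).erase y, ¬ G.Adj z x → G.Adj z y := by
    intro x
    by_cases hx : x ∈ U ∧ f x = f v
    · obtain ⟨y, hy⟩ := key x hx.1 hx.2
      exact ⟨y, fun _ _ => hy⟩
    · exact ⟨x, fun h1 h2 => absurd ⟨h1, h2⟩ hx⟩
  choose g hg using key'
  have hgf : ∀ x ∈ U, f x = f v → f (g x) = f w := fun x hx hxv =>
    (hlab _ (mem_of_mem_erase (hg x hx hxv).1)).resolve_left (hg x hx hxv).2.1
  refine hW (wins_of_three_four_sub_matching hp hlab hcv hcw hk (g := g)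
    (fun x hx hxv => mem_of_mem_erase (hg x hx hxv).1) hgf
    (fun x hx hxv => (hg x hx hxv).2.2.1) ?_ ?_)
  · intro x hx hxv u hu huw hug
    by_contra hadj
    have hux : u ≠ x := by rintro rfl; exact hvw (hxv.symm.trans huw)
    have := (hg x hx hxv).2.2.2 u (mem_erase.2 ⟨hug, mem_erase.2 ⟨hux, hu⟩⟩)
      fun h => hadj h.symm
    exact hp u hu (g x) (mem_of_mem_erase (hg x hx hxv).1) (huw.trans (hgf x hx hxv).symm) this
  · intro x hx hxv y hy hyv hyx
    refine (hg x hx hxv).2.2.2 y (mem_erase.2 ⟨?_, mem_erase.2 ⟨hyx, hy⟩⟩)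
      (hp y hy x hx (hyv.trans hxv.symm))
    rintro rfl
    exact (hg x hx hxv).2.1 hyv

/-- The graph induced by `U` is not complete multipartite with all classes of size 2. -/
def NotTuran (G : SimpleGraph V) (U : Finset V) : Prop :=
  ∃ u ∈ U, ¬ ∃! w, w ∈ U ∧ w ≠ u ∧ ¬ G.Adj u w

theorem notTuran_of_three_le {v : V} (hp : ProperOn G U f) (hv : v ∈ U)
    (h : 3 ≤ #(labelClass U f (f v))) : NotTuran G U := by
  obtain ⟨x, hx, hxv⟩ := exists_mem_label_of_three_le v hv h
  obtain ⟨y, hy, hyv⟩ := exists_mem_label_of_three_le x hv h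
  have hxU := erase_erase_subset _ _ _ hx
  have hyU := erase_erase_subset _ _ _ hy
  refine ⟨v, hv, fun ⟨w, _, hw⟩ => ne_of_mem_erase hy ?_⟩
  rw [hw x ⟨hxU, ne_of_mem_erase hx, hp v hv x hxU hxv.symm⟩,
    hw y ⟨hyU, ne_of_mem_erase (mem_of_mem_erase hy), hp v hv y hyU hyv.symm⟩]

/-- All classes have size 2, and two vertices of different classes are not adjacent. -/
theorem wins_of_all_classes_two (hp : ProperOn G U f)
    (hcl : ∀ v ∈ U, #(labelClass U f (f v)) = 2) (hn : 6 ≤ #U)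
    (hk : #(U.image f) + #U / 2 ≤ k + 2) (hT : NotTuran G U) :
    Wins G D K Player.maker U f M k := by
  obtain ⟨v, hv, hT⟩ := hT
  have hclv := hcl v hv
  refine wins_of_class_two hp hv hclv hn hk fun w hw hwv => ?_
  have hwU := mem_of_mem_erase hw
  -- The classmate `w` is one nonneighbour of `v`, and by `hT` it is not the only one. The other
  -- one, `y`, becomes a singleton class served by the colour of `v`, which replaces the class that
  -- has vanished.
  obtain ⟨y, hy, hyv, hadj, hyw⟩ : ∃ y ∈ U, y ≠ v ∧ ¬ G.Adj v y ∧ y ≠ w := by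
    by_contra! hall
    exact hT ⟨w, ⟨hwU, ne_of_mem_erase hw, hp v hv w hwU hwv.symm⟩,
      fun y hy => hall y hy.1 hy.2.1 hy.2.2⟩
  obtain ⟨l, hl⟩ := exists_unused_label U f
  have hc := card_erase_erase hv hw
  have hsub := erase_erase_subset U v w
  have hl' : ∀ u ∈ (U.erase v).erase w, f u ≠ l := fun u hu => hl u (hsub hu)
  have hyU : y ∈ (U.erase v).erase w := mem_erase.2 ⟨hyw, mem_erase.2 ⟨hyv, hy⟩⟩
  have h1 := card_labelClass_erase_self (f := f) hv
  have h2 := card_labelClass_erase_self (f := f) hw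
  rw [hwv] at h2
  have hnone : ∀ u ∈ (U.erase v).erase w, f u ≠ f v := fun u hu huv => by
    have : 0 < #(labelClass ((U.erase v).erase w) f (f v)) :=
      card_pos.2 ⟨u, mem_labelClass.2 ⟨hu, huv⟩⟩
    omega
  have hq := card_image_lt_of_label_missing hsub hv hnone
  have hq' := card_image_update_le ((U.erase v).erase w) f y l
  refine ⟨Function.update f y l, l, f v, (hp.mono hsub).update hl', (hl v hv).symm, ?_, ?_, ?_⟩
  · intro u hu he
    rw [eq_of_update_eq hl' hu he]
    exact fun h => hadj h.symm
  · intro u hu he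
    by_cases huy : u = y
    · subst huy
      rw [Function.update_self] at he
      exact absurd he.symm (hl v hv)
    · rw [Function.update_of_ne huy] at he
      exact absurd he (hnone u hu)
  · refine wins_of_alone_marked hyU (by simp) (fun u hu he => ?_) (by omega) (by omega)
    rw [Function.update_self] at he
    exact eq_of_update_eq hl' hu he

theorem exists_label_ne (hq : 2 ≤ #(U.image f)) (i : ℕ) : ∃ u ∈ U, f u ≠ i := by
  by_contra! h
  have : #(U.image f) ≤ 1 := card_le_one.2 fun a ha b hb => by
    obtain ⟨a', ha', rfl⟩ := mem_image.1 ha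
    obtain ⟨b', hb', rfl⟩ := mem_image.1 hb
    rw [h a' ha', h b' hb']
  omega

/-- Without marked classes Maker wins, unless the graph is complete multipartite with all classes
of size 2. -/
theorem wins_of_notTuran (hp : ProperOn G U f) (hn : 6 ≤ #U)
    (hk : #(U.image f) + #U / 2 ≤ k + 2) (hT : NotTuran G U) :
    Wins G D K Player.maker U f M k := by
  induction hm : #U using Nat.strong_induction_on generalizing U M k with
  | _ n ihn =>
  subst hm
  have ih : ∀ (U' : Finset V) (M' : Finset ℕ) (k' : ℕ), #U' < #U → 6 ≤ #U' →
      #(U'.image f) + #U' / 2 ≤ k' + 2 → ProperOn G U' f → NotTuran G U' →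
      Wins G D K Player.maker U' f M' k' :=
    fun U' M' k' h1 h2 h3 h4 h5 => ihn _ h1 h4 h2 h3 h5 rfl
  have ihl : ∀ (U' : Finset V) (M' : Finset ℕ) (k' : ℕ), #U' < #U → 6 ≤ #U' →
      #(U'.image f) + #U' / 2 ≤ k' + 2 → ProperOn G U' f →
      (∃ u ∈ U', 3 ≤ #(labelClass U' f (f u))) → Wins G D K Player.maker U' f M' k' :=
    fun U' M' k' h1 h2 h3 h4 ⟨u, hu, hcl⟩ => ih U' M' k' h1 h2 h3 h4 (notTuran_of_three_le h4 hu hcl)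
  clear ihn
  by_cases hone : ∃ v ∈ U, #(labelClass U f (f v)) ≤ 1
  · obtain ⟨v, hv, hcl⟩ := hone
    exact wins_of_alone hv (alone_of_card_labelClass hv hcl) (by omega) hk
  push Not at hone
  obtain ⟨v₀, hv₀⟩ : U.Nonempty := card_pos.1 (by omega)
  have hq0 := card_image_pos (f := f) hv₀
  by_cases hq1 : #(U.image f) ≤ 1
  · exact wins_of_single (i := f v₀) (by omega)
      fun u hu => label_eq_of_card_image_le_one hq1 hu hv₀
  by_cases hall2 : ∀ v ∈ U, #(labelClass U f (f v)) = 2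
  · exact wins_of_all_classes_two hp hall2 hn hk hT
  push Not at hall2
  obtain ⟨y, hy, hcly⟩ := hall2
  have hcly' := hone y hy
  -- If Breaker finishes off the pair with a new colour, q drops and the class with at least four
  -- vertices keeps the rest from being of Turán type.
  by_cases h24 : (∃ v ∈ U, #(labelClass U f (f v)) = 2) ∧ ∃ z ∈ U, 4 ≤ #(labelClass U f (f z))
  · obtain ⟨⟨v, hv, hclv⟩, z, hz, hclz⟩ := h24
    refine wins_of_class_two hp hv hclv hn hk fun w hw hwv => ?_
    refine hasAnswerNew_of_wins hp hv ?_
    have hc := card_erase_erase hv hw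
    have hsub := erase_erase_subset U v w
    have h1 := card_labelClass_erase_self (f := f) hv
    have h2 := card_labelClass_erase_self (f := f) hw
    rw [hwv] at h2
    have hnone : ∀ u ∈ (U.erase v).erase w, f u ≠ f v := fun u hu huv => by
      have : 0 < #(labelClass ((U.erase v).erase w) f (f v)) :=
        card_pos.2 ⟨u, mem_labelClass.2 ⟨hu, huv⟩⟩
      omega
    have hq := card_image_lt_of_label_missing hsub hv hnone
    have hother : ∀ i, i ≠ f v →
        labelClass ((U.erase v).erase w) f i = labelClass U f i := fun i hi => by
      rw [labelClass_erase_of_ne (by rw [hwv]; exact hi.symm), labelClass_erase_of_ne hi.symm]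
    have hzv : f z ≠ f v := fun h => by rw [h] at hclz; omega
    have hzU : z ∈ (U.erase v).erase w := mem_erase.2
      ⟨by rintro rfl; exact hzv hwv, mem_erase.2 ⟨by rintro rfl; exact hzv rfl, hz⟩⟩
    by_cases hq1' : #(((U.erase v).erase w).image f) ≤ 1
    · exact wins_of_single (i := f z) (by omega)
        fun u hu => label_eq_of_card_image_le_one hq1' hu hzU
    · obtain ⟨t, ht, htz⟩ := exists_label_ne (f := f) (not_le.1 hq1') (f z)
      have := card_labelClass_add_le (U := (U.erase v).erase w) (f := f) htz
      rw [hother _ hzv, hother _ (hnone t ht)] at this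
      have := hone t (hsub ht)
      exact ihl _ _ _ (by omega) (by omega) (by omega) (hp.mono hsub)
        ⟨z, hzU, by rw [hother _ hzv]; omega⟩
  by_cases h3 : ∃ v ∈ U, #(labelClass U f (f v)) = 3
  · obtain ⟨v, hv, hclv⟩ := h3
    obtain ⟨z, hz, hzv⟩ := exists_label_ne (f := f) (not_le.1 hq1) (f v)
    -- Two classes of sizes 3 and 3, or 3 and 4, are treated apart: equal sizes are not covered by
    -- `wins_of_two_labels`, and seven vertices leave only five after a round.
    by_cases hq3 : #(U.image f) ≤ 2 ∧ #(labelClass U f (f z)) ≤ 4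
    · obtain ⟨hq2, hz4⟩ := hq3
      have hlab := labels_of_card_image_le_two hq2 hv hz hzv.symm
      have hcard := card_eq_of_two_labels hzv.symm hlab
      by_cases hz4' : #(labelClass U f (f z)) = 4
      · exact wins_of_three_four hp hv hz hzv.symm hq2 hclv hz4'
          (by have := two_le_card_image hv hz hzv.symm; omega)
      · have := hone z hz
        exact wins_of_equal_classes hp hlab hclv.ge (by omega)
          (by have := two_le_card_image hv hz hzv.symm; omega)
    have hq3' : 3 ≤ #(U.image f) ∨ ∀ u ∈ U, f u ≠ f v → 5 ≤ #(labelClass U f (f u)) := by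
      refine or_iff_not_imp_left.2 fun h u hu huv => ?_
      have hlab := labels_of_card_image_le_two (by omega) hv hz hzv.symm
      rw [(hlab u hu).resolve_left huv]
      omega
    have hq3'' : ∀ x ∈ U, #(labelClass U f (f x)) = 3 →
        (3 ≤ #(U.image f) ∨ ∀ u ∈ U, f u ≠ f x → #(labelClass U f (f u)) ≠ 3) := by
      refine fun x hx hclx => hq3'.imp_right fun h u hu hux hclu => ?_
      have h1 : f u = f v := by by_contra hne; have := h u hu hne; omega
      have h2 : f x = f v := by by_contra hne; have := h x hx hne; omega
      exact hux (h1.trans h2.symm)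
    -- After an opening at such an `x`, Breaker cannot repeat its colour outside its class.
    by_cases hfull : ∃ x ∈ U, #(labelClass U f (f x)) = 3 ∧ ∀ u ∈ U, f u ≠ f x → G.Adj x u
    · obtain ⟨x, hx, hclx, hfull⟩ := hfull
      exact wins_of_class_three hp hx hclx hn hk (hq3'' x hx hclx)
        fun w hw hwx hadj => absurd (hfull w (mem_of_mem_erase hw) hwx) hadj
    push Not at hfull
    refine wins_of_class_three hp hv hclv hn hk (hq3'' v hv hclv) fun w hw hwv hadj => ?_
    have hwU := mem_of_mem_erase hw
    by_cases hcom : ∃ x ∈ (U.erase v).erase w, ¬ G.Adj x v ∧ ¬ G.Adj x w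
    · obtain ⟨x, hx, hxv, hxw⟩ := hcom
      exact hasAnswer_of_common hp hv hw hx hxv hxw hn hk
    refine hasAnswer_of_wins hp ?_
    have hc := card_erase_erase hv hw
    have hsub := erase_erase_subset U v w
    have hq' := card_le_card (image_subset_image (f := f) hsub)
    by_cases hone' : ∃ x ∈ (U.erase v).erase w, #(labelClass ((U.erase v).erase w) f (f x)) ≤ 1
    · obtain ⟨x, hx, hclx⟩ := hone'
      exact wins_of_alone hx (alone_of_card_labelClass hx hclx) (by omega) (by omega)
    push Not at hone'
    have hn' : 6 ≤ #((U.erase v).erase w) := by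
      rcases hq3' with hq3' | hq3'
      · have hmul : 2 * #(((U.erase v).erase w).image f) ≤ #((U.erase v).erase w) := by
          refine mul_card_image_le_card _ _ fun i hi => ?_
          obtain ⟨x, hx, rfl⟩ := mem_image.1 hi
          exact hone' x hx
        have hqq : #(U.image f) ≤ #(((U.erase v).erase w).image f) := by
          by_contra hlt
          obtain ⟨i, hi, hi'⟩ : ∃ i ∈ U.image f, i ∉ ((U.erase v).erase w).image f := by
            by_contra! hall
            exact hlt (card_le_card hall)
          obtain ⟨u, hu, rfl⟩ := mem_image.1 hi
          have hnone : ∀ x ∈ (U.erase v).erase w, f x ≠ f u := fun x hx hxu =>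
            hi' (hxu ▸ mem_image_of_mem f hx)
          by_cases huv : f u = f v
          · obtain ⟨x, hx, hxv⟩ := exists_mem_label_of_three_le w hv hclv.ge
            exact hnone x hx (hxv.trans huv.symm)
          by_cases huw : f u = f w
          · have h1 := hone w hwU
            have h2 := card_labelClass_erase_self (f := f) hw
            rw [labelClass_erase_of_ne (fun e => hwv e.symm)] at h2
            obtain ⟨x, hx⟩ := card_pos.1
              (show 0 < #(labelClass ((U.erase v).erase w) f (f w)) by omega)
            obtain ⟨hx, hxw⟩ := mem_labelClass.1 hx
            exact hnone x hx (hxw.trans huw.symm)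
          · refine hnone u (mem_erase.2 ⟨?_, mem_erase.2 ⟨?_, hu⟩⟩) rfl
            · rintro rfl; exact huw rfl
            · rintro rfl; exact huv rfl
        omega
      · have := hq3' w hwU hwv
        have := card_labelClass_add_le (U := U) (f := f) hwv
        omega
    refine ih _ _ _ (by omega) hn' (by omega) (hp.mono hsub) ?_
    -- A classmate `x` of `v` has two nonneighbours left: its classmate `x'`, and a vertex `u` of
    -- another class, which exists because `x` is not joined to everything outside its class. Here
    -- `u ≠ w`, since otherwise `x` would be a common nonneighbour of `v` and `w`.
    by_contra hT'
    have hT'' : ∀ u ∈ (U.erase v).erase w,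
        ∃! x, x ∈ (U.erase v).erase w ∧ x ≠ u ∧ ¬ G.Adj u x := by
      intro u hu
      by_contra hne
      exact hT' ⟨u, hu, hne⟩
    have h1 := card_labelClass_erase_self (f := f) hv
    obtain ⟨x, hx, hxv⟩ := exists_mem_label_of_three_le w hv hclv.ge
    obtain ⟨x', hx', hxx'⟩ : ∃ x' ∈ labelClass (U.erase v) f (f v), x' ≠ x := by
      by_contra! hall
      have : #(labelClass (U.erase v) f (f v)) ≤ 1 := card_le_one.2 fun a ha b hb => by
        rw [hall a ha, hall b hb]
      omega
    obtain ⟨hx'U, hx'v⟩ := mem_labelClass.1 hx'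
    have hx'U' : x' ∈ (U.erase v).erase w :=
      mem_erase.2 ⟨by rintro rfl; exact hwv hx'v, hx'U⟩
    obtain ⟨u, hu, hux, hadj'⟩ := hfull x (hsub hx) (by rw [hxv, hclv])
    rw [hxv] at hux
    by_cases huw : u = w
    · subst huw
      exact hcom ⟨x, hx, hp x (hsub hx) v hv hxv, hadj'⟩
    · have huU : u ∈ (U.erase v).erase w :=
        mem_erase.2 ⟨huw, mem_erase.2 ⟨by rintro rfl; exact hux rfl, hu⟩⟩
      have := (hT'' x hx).unique ⟨huU, by rintro rfl; exact hux hxv, hadj'⟩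
        ⟨hx'U', hxx', hp x (hsub hx) x' (hsub hx'U') (hxv.trans hx'v.symm)⟩
      rw [this] at hux
      exact hux hx'v
  -- all classes have at least 4 vertices
  have hall4 : ∀ u ∈ U, 4 ≤ #(labelClass U f (f u)) := by
    push Not at h3
    have hy4 : 4 ≤ #(labelClass U f (f y)) := by
      have := h3 y hy
      omega
    intro u hu
    have h1 := h3 u hu
    have h2 := hone u hu
    have h4 : #(labelClass U f (f u)) ≠ 2 := fun h => h24 ⟨⟨u, hu, h⟩, y, hy, hy4⟩
    omega
  -- Opening in a smallest class gives, for two classes of unequal sizes, the gap required by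
  -- `wins_of_marked_among_large` after two vertices of that class are gone.
  obtain ⟨v, hv, hmin⟩ := exists_min_image U (fun u => #(labelClass U f (f u))) ⟨v₀, hv₀⟩
  have hv4 := hall4 v hv
  obtain ⟨z, hz, hzv⟩ := exists_label_ne (f := f) (not_le.1 hq1) (f v)
  have hz4 := hall4 z hz
  by_cases heq : #(U.image f) ≤ 2 ∧ #(labelClass U f (f v)) = #(labelClass U f (f z))
  · have hlab := labels_of_card_image_le_two heq.1 hv hz hzv.symm
    have hcard := card_eq_of_two_labels hzv.symm hlab
    exact wins_of_equal_classes hp hlab (by omega) heq.2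
      (by have := two_le_card_image hv hz hzv.symm; omega)
  have hq3 : 3 ≤ #(U.image f) ∨
      ∀ u ∈ U, f u ≠ f v → #(labelClass U f (f v)) ≠ #(labelClass U f (f u)) := by
    refine or_iff_not_imp_left.2 fun h u hu huv he => heq ⟨by omega, ?_⟩
    have hlab := labels_of_card_image_le_two (by omega) hv hz hzv.symm
    rw [he, (hlab u hu).resolve_left huv]
  refine wins_of_class_three_le hp hv (by omega) hn hk hq3 (fun w hw hwv => ?_)
    fun w hw hwv _ => ?_
  · have hc := card_erase_erase hv hw
    have hsub := erase_erase_subset U v w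
    have hq' := card_le_card (image_subset_image (f := f) hsub)
    have h1 := card_labelClass_erase_self (f := f) hv
    have h2 := card_labelClass_erase_self (f := f) hw
    rw [hwv] at h2
    have hother : ∀ i, i ≠ f v →
        labelClass ((U.erase v).erase w) f i = labelClass U f i := fun i hi => by
      rw [labelClass_erase_of_ne (by rw [hwv]; exact hi.symm), labelClass_erase_of_ne hi.symm]
    obtain ⟨x, hx, hxv⟩ := exists_mem_label_of_three_le (f := f) w hv (by omega)
    have hother' : ∀ u ∈ U, f u ≠ f v → u ∈ (U.erase v).erase w := fun u hu huv =>
      mem_erase.2 ⟨by rintro rfl; exact huv hwv, mem_erase.2 ⟨by rintro rfl; exact huv rfl, hu⟩⟩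
    refine hasAnswerNew_of_wins hp hv (wins_of_marked_among_large (hp.mono hsub) hx (by simp [hxv])
      (hother' z hz hzv) (by rw [hxv]; exact hzv) ?_ ?_ (by omega)
      fun U' M' k' hU' => ihl U' M' k' (by omega))
    · intro u hu hux
      rw [hxv] at hux
      rw [hother _ hux]
      exact hall4 u (hsub hu)
    · rcases hq3 with hq3 | -
      · refine Or.inl (hq3.trans (card_le_card fun i hi => ?_))
        obtain ⟨u, hu, rfl⟩ := mem_image.1 hi
        by_cases huv : f u = f v
        · rw [huv, ← hxv]
          exact mem_image_of_mem f hx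
        · exact mem_image_of_mem f (hother' u hu huv)
      · refine Or.inr fun u hu hux => ?_
        rw [hxv] at hux ⊢
        rw [hother _ hux]
        have := hmin u (hsub hu)
        omega
  · have hc := card_erase_erase hv hw
    have hsub := erase_erase_subset U v w
    have hq' := card_le_card (image_subset_image (f := f) hsub)
    have h1 := card_labelClass_erase_self (f := f) hv
    have h2 := labelClass_erase_of_ne (U := U.erase v) hwv
    obtain ⟨x, hx, hxv⟩ := exists_mem_label_of_two_le hv hwv (by omega)
    have hsum := card_labelClass_add_le (U := U) (f := f) hwv
    have := hall4 w (mem_of_mem_erase hw)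
    exact hasAnswer_of_wins hp (ihl _ _ _ (by omega) (by omega) (by omega) (hp.mono hsub)
      ⟨x, hx, by rw [hxv, h2]; omega⟩)

end Unmarked

/-! ### Turán graphs and the initial position. -/

section Initial

open Finset

variable {V : Type*} [Fintype V] [DecidableEq V] {G : SimpleGraph V}

/-- If the fibres of `h` have size 2 and are the classes of nonadjacent vertices, then the graph is
a Turán graph. -/
theorem nonempty_iso_turanGraph_of_fibres {Q : Type*} [Fintype Q] [DecidableEq Q] (h : V → Q)
    (hadj : ∀ u w, G.Adj u w ↔ h u ≠ h w) (hcard : ∀ q, Fintype.card {v // h v = q} = 2) :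
    Nonempty (G ≃g SimpleGraph.turanGraph (2 * Fintype.card Q) (Fintype.card Q)) := by
  let e : V ≃ Fin (Fintype.card Q) × Fin 2 := (Equiv.sigmaFiberEquiv h).symm.trans
    ((Equiv.sigmaCongrRight fun q => Fintype.equivFinOfCardEq (hcard q)).trans
      ((Equiv.sigmaEquivProd _ _).trans (Equiv.prodCongr (Fintype.equivFin Q) (Equiv.refl _))))
  have he : ∀ v, (e v).1 = Fintype.equivFin Q (h v) := fun v => rfl
  have iso : G ≃g SimpleGraph.completeEquipartiteGraph (Fintype.card Q) 2 :=
    ⟨e, fun {u w} => by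
      rw [SimpleGraph.completeEquipartiteGraph_adj, he, he, hadj]
      simp⟩
  rw [mul_comm]
  exact ⟨iso.trans SimpleGraph.completeEquipartiteGraph.turanGraph⟩

/-- If every vertex has exactly one nonneighbour, taking it is an involution without fixed points,
and its orbits are the parts of a Turán graph. -/
theorem notTuran_univ
    (hG : ∀ r : ℕ, ¬ Nonempty (G ≃g SimpleGraph.turanGraph (2 * r) r)) :
    NotTuran G (univ : Finset V) := by
  classical
  by_contra hT
  have hT' : ∀ u, ∃! w, w ≠ u ∧ ¬ G.Adj u w := by
    intro u
    by_contra hne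
    exact hT ⟨u, mem_univ u, by simpa using hne⟩
  choose g hg hgu using hT'
  have hgg : ∀ u, g (g u) = u := fun u =>
    (hgu (g u) u ⟨(hg u).1.symm, fun h => (hg u).2 h.symm⟩).symm
  let S : Setoid V :=
    { r := fun u w => u = w ∨ g u = w
      iseqv :=
        { refl := fun u => Or.inl rfl
          symm := by
            rintro u w (rfl | rfl)
            · exact Or.inl rfl
            · exact Or.inr (hgg u)
          trans := by
            rintro u w x (rfl | rfl) (rfl | rfl)
            · exact Or.inl rfl
            · exact Or.inr rfl
            · exact Or.inr rfl
            · exact Or.inl (hgg u).symm } }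
  have hS : ∀ u w, Quotient.mk S u = Quotient.mk S w ↔ u = w ∨ g u = w := fun u w =>
    Quotient.eq (r := S)
  refine hG _ (nonempty_iso_turanGraph_of_fibres (Quotient.mk S) (fun u w => ?_) fun q => ?_)
  · rw [Ne, hS]
    constructor
    · rintro h (rfl | rfl)
      · exact G.irrefl h
      · exact (hg u).2 h
    · intro h
      by_contra hadj
      exact h (Or.inr (hgu u w ⟨fun e => h (Or.inl e.symm), hadj⟩).symm)
  · induction q using Quotient.inductionOn with
    | h v =>
      rw [Fintype.card_subtype, card_eq_two]
      refine ⟨v, g v, (hg v).1.symm, ?_⟩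
      ext u
      simp only [mem_filter, mem_univ, true_and, mem_insert, mem_singleton, hS]
      constructor
      · rintro (h | rfl)
        · exact Or.inl h
        · exact Or.inr (hgg u).symm
      · rintro (h | rfl)
        · exact Or.inl h
        · exact Or.inr (hgg v)

theorem chiGB_le_of_makerWins {ι : Type*} [DecidableEq ι] [Fintype ι] {D : ι → Finset V} {k : ℕ}
    (h : MakerWins G D k) : chiGB G D ≤ k := iInf₂_le k h

theorem isFresh_initial (ι : Type*) [Fintype ι] (K : ℕ) :
    (Position.initial V ι K).IsFresh univ univ :=
  ⟨fun v => by simp [Position.initial], fun c _ v => by simp [Position.initial]⟩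

end Initial

end BlankGame

/-! ### The main theorem. -/

open BlankGame Finset in
theorem mainTheorem1 {V : Type*} [Fintype V] [DecidableEq V] (G : SimpleGraph V)
    (hn : 2 ≤ Fintype.card V)
    (p : ℕ) (hp : G.chromaticNumber ≤ (p : ℕ∞))
    (C : Fin p → Finset V)
    (hindep : ∀ i, G.IsIndepSet (C i : Set V))
    (hdisj : ∀ i j, i ≠ j → Disjoint (C i) (C j))
    (hcover : ∀ v, ∃ i, v ∈ C i)
    (s : ℕ) (d : Fin s ↪ Fin p)
    (h : 1 ≤ s ∨
      (6 ≤ Fintype.card V ∧ ∀ r : ℕ, ¬ Nonempty (G ≃g SimpleGraph.turanGraph (2 * r) r))) :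
    BlankGame.chiGB G (fun i : Fin s => C (d i)) + 2 ≤
      ((p + Fintype.card V / 2 : ℕ) : ℕ∞) := by
  choose c hc using hcover
  have hcC : ∀ v i, v ∈ C i → c v = i := fun v i hi => by
    by_contra hne
    exact disjoint_left.1 (hdisj _ _ hne) (hc v) hi
  obtain ⟨v₀⟩ : Nonempty V := Fintype.card_pos_iff.1 (by omega)
  have hp1 : 1 ≤ p := (Nat.zero_le _).trans_lt (c v₀).isLt
  have hproper : ProperOn G univ fun v => (c v : ℕ) := by
    intro u _ w _ huw hadj
    have huw' : c u = c w := Fin.ext huw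
    exact hindep (c u) (hc u) (huw' ▸ hc w) hadj.ne hadj
  have himg : ((univ : Finset V).image fun v => (c v : ℕ)) = (univ.image c).image Fin.val := by
    rw [image_image]; rfl
  have hq : #((univ : Finset V).image fun v => (c v : ℕ)) ≤ p := by
    rw [himg]
    exact card_image_le.trans ((card_le_univ _).trans (by simp))
  have hV : #(univ : Finset V) = Fintype.card V := card_univ
  obtain ⟨K, hK⟩ : ∃ K, p + Fintype.card V / 2 = K + 2 := ⟨p + Fintype.card V / 2 - 2, by omega⟩
  have hchi : chiGB G (fun i : Fin s => C (d i)) ≤ K := by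
    refine chiGB_le_of_makerWins ?_
    have hfresh := isFresh_initial (V := V) (Fin s) K
    rcases h with hs | ⟨h6, hT⟩
    · let t : Fin s := ⟨0, hs⟩
      have hreal : (Position.initial V (Fin s) K).Realises G (fun i => C (d i)) univ
          (fun v => (c v : ℕ)) {(d t : ℕ)} K := by
        refine ⟨hproper, univ, hfresh, by simp, fun _ => Sum.inl t, by simp, fun i hi => ?_⟩
        rw [mem_singleton] at hi
        subst hi
        refine ⟨mem_univ t, fun v hv => ?_⟩
        have : c v = d t := Fin.ext hv.2
        show v ∈ C (d t)
        rw [← this]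
        exact hc v
      -- The class marked at the start may be empty; then it is of no use to Maker, but at most p -
      -- 1 classes are nonempty and `wins_weak` applies.
      by_cases hne : ∃ v, c v = d t
      · obtain ⟨v, hv⟩ := hne
        exact wins_strong (by omega) (by omega) ⟨v, mem_univ v, by simp [hv]⟩ _ hreal
      · push Not at hne
        have hq' : #((univ : Finset V).image fun v => (c v : ℕ)) + 1 ≤ p := by
          have hlt : #(univ.image c) < #(univ : Finset (Fin p)) :=
            card_lt_univ_of_notMem (x := d t) (by simpa using hne)
          rw [card_fin] at hlt
          rw [himg]
          exact Nat.succ_le_of_lt (card_image_le.trans_lt hlt)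
        exact wins_weak (by omega) (by omega) _ hreal
    · have hreal : (Position.initial V (Fin s) K).Realises G (fun i => C (d i)) univ
          (fun v => (c v : ℕ)) ∅ K :=
        ⟨hproper, univ, hfresh, by simp, fun _ => Sum.inr ⟨0, by omega⟩, by simp, by simp⟩
      exact wins_of_notTuran hproper (by omega) (by omega) (notTuran_univ hT) _ hreal
  rw [hK]
  push_cast
  exact add_le_add hchi le_rfl
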